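/- **Theorem (Well-posedness and strong stability).** Let $\ell_1,\ell_2>0$ and let $\alpha_1,\alpha_2,\beta_1,\gamma_1,\delta_1,\tau_1,\kappa_1$ be positive real constants. All functions are complex valued, $H^k(0,\ell)$ denotes the usual Sobolev space based on $L^2(0,\ell)$, and $\|\cdot\|$ is the $L^2$-norm. Let $$V=\{(f_1,f_2)\in H^1(0,\ell_1)\times H^2(0,\ell_2)\;:\; f_1(\ell_1)=0,\ f_2(\ell_2)=0,\ f_1(0)=f_2(0),\ \partial_xf_2(0)=0\},$$ and let $\mathcal H_1=V\times\big(L^2(0,\ell_1)\times L^2(0,\ell_2)\big)\times L^2(0,\ell_1)\times L^2(0,\ell_1)$ be equipped with the Hilbertian norm $$\|(u,v,\theta_1,q_1)\|_{\mathcal H_1}^2=\tfrac{\delta_1\alpha_1}{\beta_1}\|\partial_xu_1\|^2+\tfrac{\delta_1}{\beta_1}\|v_1\|^2+\|\theta_1\|^2+\tfrac{\gamma_1\tau_1}{\kappa_1}\|q_1\|^2+\alpha_2\|\partial_x^2u_2\|^2+\|v_2\|^2 ,$$ where $u=(u_1,u_2)$ and $v=(v_1,v_2)$. Let $\mathcal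 A_1$ be the unbounded operator on $\mathcal H_1$ whose domain $\mathcal D(\mathcal A_1)$ consists of all $y=(u,v,\theta_1,q_1)$ with $u\in V\cap(H^2(0,\ell_1)\times H^4(0,\ell_2))$, $v\in V$, $\theta_1\in H^1_0(0,\ell_1)$, $q_1\in H^1(0,\ell_1)$ and $$\partial_x^2u_2(\ell_2)=0,\qquad \alpha_2\,\partial_x^3u_2(0)=\tfrac{\delta_1}{\beta_1}\,\alpha_1\,\partial_xu_1(0),$$ given by $$\mathcal A_1 y=\Big((v_1,v_2),\ \big(\alpha_1\partial_x^2u_1-\beta_1\partial_x\theta_1,\ -\alpha_2\partial_x^4u_2\big),\ -\gamma_1\partial_xq_1-\delta_1\partial_xv_1,\ -\tfrac1{\tau_1}q_1-\tfrac{\kappa_1}{\tau_1}\partial_x\theta_1\Big).$$ (This is the first-order form of a string with Cattaneo heat conduction coupled at $x=0$ to an elastic beam.) Then $\mathcal A_1$ is the infinitesimal generator of a $C_0$-semigroup of contractions $(S_1(t))_{t\ge0}$ on $\mathcal H_1$, and this semigroup is strongly stable: $$\lim_{t\to\infty}\|S_1(t)y^0\|_{\mathcal H_1}=0\qquad\text{for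 all }y^0\in\mathcal H_1 .$$ -/

import Mathlib

open MeasureTheory Set Filter Topology
open scoped NNReal ContDiff ComplexConjugate

noncomputable section

namespace StringBeam

/-! ## Sobolev spaces on a bounded interval -/

/-- The complex Lebesgue space `L²(0, ℓ)`. -/
abbrev L2 (ℓ : ℝ) : Type := Lp ℂ 2 (volume.restrict (Ioo (0 : ℝ) ℓ))

/-- `φ` is a test function on `(0, ℓ)`: smooth, with compact support contained in `(0, ℓ)`. -/
structure IsTest (ℓ : ℝ) (φ : ℝ → ℝ) : Prop where
  smooth : ContDiff ℝ ∞ φ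
  compact : HasCompactSupport φ
  subset : tsupport φ ⊆ Ioo 0 ℓ

/-- `g ∈ L²(0, ℓ)` is the weak derivative of `f ∈ L²(0, ℓ)`. -/
def IsWeakDeriv {ℓ : ℝ} (f g : L2 ℓ) : Prop :=
  ∀ φ : ℝ → ℝ, IsTest ℓ φ →
    ∫ x in Ioo (0 : ℝ) ℓ, deriv φ x • f x = - ∫ x in Ioo (0 : ℝ) ℓ, φ x • g x

lemma L2.integrable {ℓ : ℝ} (f : L2 ℓ) : Integrable f (volume.restrict (Ioo (0 : ℝ) ℓ)) :=
  (Lp.memLp f).integrable (by norm_num)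

lemma L2.integrable_smul {ℓ : ℝ} (f : L2 ℓ) {φ : ℝ → ℝ} (hc : Continuous φ)
    (hs : HasCompactSupport φ) :
    Integrable (fun x => φ x • f x) (volume.restrict (Ioo (0 : ℝ) ℓ)) := by
  obtain ⟨C, hC⟩ := hs.exists_bound_of_continuous hc
  exact f.integrable.bdd_smul C hc.aestronglyMeasurable (ae_of_all _ hC)

lemma IsTest.continuous_deriv {ℓ : ℝ} {φ : ℝ → ℝ} (h : IsTest ℓ φ) : Continuous (deriv φ) :=
  h.smooth.continuous_deriv (by simp)

lemma IsWeakDeriv.zero {ℓ : ℝ} : IsWeakDeriv (0 : L2 ℓ) 0 := by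
  intro φ hφ
  have h : ∀ ψ : ℝ → ℝ, ∫ x in Ioo (0 : ℝ) ℓ, ψ x • (0 : L2 ℓ) x = 0 := by
    intro ψ
    refine integral_eq_zero_of_ae ?_
    filter_upwards [Lp.coeFn_zero ℂ 2 (volume.restrict (Ioo (0 : ℝ) ℓ))] with x hx
    rw [hx]
    exact smul_zero _
  rw [h, h, neg_zero]

lemma IsWeakDeriv.add {ℓ : ℝ} {f g f' g' : L2 ℓ} (hf : IsWeakDeriv f f') (hg : IsWeakDeriv g g') :
    IsWeakDeriv (f + g) (f' + g') := by
  intro φ hφ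
  have key : ∀ (ψ : ℝ → ℝ) (a b : L2 ℓ), Continuous ψ → HasCompactSupport ψ →
      ∫ x in Ioo (0 : ℝ) ℓ, ψ x • (a + b : L2 ℓ) x =
        (∫ x in Ioo (0 : ℝ) ℓ, ψ x • a x) + ∫ x in Ioo (0 : ℝ) ℓ, ψ x • b x := by
    intro ψ a b hc hs
    rw [← integral_add (a.integrable_smul hc hs) (b.integrable_smul hc hs)]
    refine integral_congr_ae ?_
    filter_upwards [Lp.coeFn_add a b] with x hx
    rw [hx]
    exact smul_add _ _ _
  rw [key _ _ _ hφ.continuous_deriv hφ.compact.deriv,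
    key _ _ _ hφ.smooth.continuous hφ.compact, hf φ hφ, hg φ hφ, neg_add]

lemma IsWeakDeriv.smul {ℓ : ℝ} {f f' : L2 ℓ} (c : ℂ) (hf : IsWeakDeriv f f') :
    IsWeakDeriv (c • f) (c • f') := by
  intro φ hφ
  have key : ∀ (ψ : ℝ → ℝ) (a : L2 ℓ),
      ∫ x in Ioo (0 : ℝ) ℓ, ψ x • (c • a : L2 ℓ) x = c * ∫ x in Ioo (0 : ℝ) ℓ, ψ x • a x := by
    intro ψ a
    rw [← integral_const_mul]
    refine integral_congr_ae ?_
    filter_upwards [Lp.coeFn_smul c a] with x hx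
    simp only [hx, Pi.smul_apply, smul_eq_mul, Complex.real_smul]
    ring
  rw [key, key, hf φ hφ, mul_neg]

lemma ae_zero_of_test {ℓ : ℝ} {h : ℝ → ℂ} (hi : IntegrableOn h (Ioo 0 ℓ))
    (H : ∀ φ : ℝ → ℝ, IsTest ℓ φ → ∫ x in Ioo (0 : ℝ) ℓ, φ x • h x = 0) :
    h =ᵐ[volume.restrict (Ioo (0 : ℝ) ℓ)] 0 := by
  have := isOpen_Ioo.ae_eq_zero_of_integral_contDiff_smul_eq_zero (U := Ioo (0 : ℝ) ℓ)
    (μ := volume) (f := h) hi.locallyIntegrableOn (by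
      intro φ h1 h2 h3
      rw [← H φ ⟨h1, h2, h3⟩]
      symm
      refine setIntegral_eq_integral_of_forall_compl_eq_zero ?_
      intro x hx
      rw [image_eq_zero_of_notMem_tsupport (fun h => hx (h3 h)), zero_smul])
  exact (ae_restrict_iff' measurableSet_Ioo).2 this

lemma IsWeakDeriv.unique {ℓ : ℝ} {f g g' : L2 ℓ} (h : IsWeakDeriv f g) (h' : IsWeakDeriv f g') :
    g = g' := by
  have h0 := ae_zero_of_test (ℓ := ℓ) (h := fun x => g x - g' x)
    (g.integrable.sub g'.integrable) (by
      intro φ hφ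
      have e : ∀ x, φ x • (g x - g' x) = φ x • g x - φ x • g' x := fun x => smul_sub _ _ _
      simp only [e]
      rw [integral_sub (g.integrable_smul hφ.smooth.continuous hφ.compact)
        (g'.integrable_smul hφ.smooth.continuous hφ.compact)]
      have := (h φ hφ).symm.trans (h' φ hφ)
      rw [neg_inj] at this
      rw [this, sub_self])
  refine Lp.ext ?_
  filter_upwards [h0] with x hx
  exact sub_eq_zero.1 hx

/-- The primitive of a test function with zero mean is a test function. -/
lemma IsTest.primitive {ℓ : ℝ} {η : ℝ → ℝ} (h : IsTest ℓ η) (h0 : ∫ x, η x = 0) :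
    ∃ χ : ℝ → ℝ, IsTest ℓ χ ∧ deriv χ = η := by
  obtain ⟨a, b, ha, hb, hab⟩ : ∃ a b : ℝ, 0 < a ∧ b < ℓ ∧ tsupport η ⊆ Icc a b := by
    have hK : IsCompact (tsupport η) := h.compact
    rcases (tsupport η).eq_empty_or_nonempty with he | hn
    · exact ⟨1, ℓ - 1, one_pos, by linarith, by simp [he]⟩
    · obtain ⟨a, ha⟩ := hK.exists_isLeast hn
      obtain ⟨b, hb⟩ := hK.exists_isGreatest hn
      exact ⟨a, b, (h.subset ha.1).1, (h.subset hb.1).2, fun x hx => ⟨ha.2 hx, hb.2 hx⟩⟩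
  have hz : ∀ x, x ∉ Icc a b → η x = 0 := fun x hx =>
    image_eq_zero_of_notMem_tsupport fun h' => hx (hab h')
  have hd : deriv (fun x => ∫ t in (0 : ℝ)..x, η t) = η := by
    funext x
    exact Continuous.deriv_integral η h.smooth.continuous 0 x
  have hsupp : tsupport (fun x => ∫ t in (0 : ℝ)..x, η t) ⊆ Icc a b := by
    refine closure_minimal ?_ isClosed_Icc
    intro x hx
    by_contra hx'
    apply hx
    rw [mem_Icc, not_and_or, not_le, not_le] at hx'
    rcases hx' with hx' | hx'
    · change ∫ t in (0 : ℝ)..x, η t = 0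
      rw [intervalIntegral.integral_congr (g := fun _ => (0 : ℝ))]
      · simp
      · intro t ht
        refine hz t fun hh => ?_
        have := ht.2
        have h2 : max 0 x < a := max_lt ha hx'
        linarith [hh.1]
    · change ∫ t in (0 : ℝ)..x, η t = 0
      rw [intervalIntegral.integral_eq_integral_of_support_subset, h0]
      intro t ht
      have : t ∈ Icc a b := by
        by_contra hh
        exact ht (hz t hh)
      exact ⟨by linarith [this.1], by linarith [this.2]⟩
  refine ⟨_, ⟨?_, isCompact_Icc.of_isClosed_subset (isClosed_tsupport _) hsupp, ?_⟩, hd⟩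
  · rw [contDiff_infty_iff_deriv, hd]
    refine ⟨fun x => ?_, h.smooth⟩
    exact (intervalIntegral.integral_hasDerivAt_right
      (h.smooth.continuous.intervalIntegrable _ _)
      (h.smooth.continuous.stronglyMeasurableAtFilter _ _)
      h.smooth.continuous.continuousAt).differentiableAt
  · intro x hx
    exact ⟨by linarith [(hsupp hx).1], by linarith [(hsupp hx).2]⟩

/-- A function with vanishing weak derivative is constant. -/
lemma IsWeakDeriv.const_of_zero {ℓ : ℝ} (hℓ : 0 < ℓ) {f : L2 ℓ} (h : IsWeakDeriv f 0) :
    ∃ c : ℂ, f =ᵐ[volume.restrict (Ioo (0 : ℝ) ℓ)] fun _ => c := by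
  let B : ContDiffBump (ℓ / 2) := ⟨ℓ / 8, ℓ / 4, by linarith, by linarith⟩
  let ψ : ℝ → ℝ := B.normed volume
  have hψ : IsTest ℓ ψ := by
    refine ⟨B.contDiff_normed, B.hasCompactSupport_normed, ?_⟩
    rw [B.tsupport_normed_eq, Real.closedBall_eq_Icc]
    intro x hx
    have h1 : ℓ / 2 - ℓ / 4 ≤ x := hx.1
    have h2 : x ≤ ℓ / 2 + ℓ / 4 := hx.2
    exact ⟨by linarith, by linarith⟩
  have hψ1 : ∫ x, ψ x = 1 := B.integral_normed
  let c : ℂ := ∫ x in Ioo (0 : ℝ) ℓ, ψ x • f x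
  have hzero : ∀ χ : ℝ → ℝ, IsTest ℓ χ → ∫ x in Ioo (0 : ℝ) ℓ, deriv χ x • f x = 0 := by
    intro χ hχ
    rw [h χ hχ, neg_eq_zero]
    refine integral_eq_zero_of_ae ?_
    filter_upwards [Lp.coeFn_zero ℂ 2 (volume.restrict (Ioo (0 : ℝ) ℓ))] with x hx
    rw [hx]
    exact smul_zero _
  refine ⟨c, ?_⟩
  have h0 := ae_zero_of_test (ℓ := ℓ) (h := fun x => f x - c)
    (f.integrable.sub (integrable_const c)) (by
      intro φ hφ
      let m : ℝ := ∫ x, φ x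
      have hm : ∫ x in Ioo (0 : ℝ) ℓ, φ x = m := by
        refine setIntegral_eq_integral_of_forall_compl_eq_zero fun x hx => ?_
        exact image_eq_zero_of_notMem_tsupport fun h' => hx (hφ.subset h')
      have hη : IsTest ℓ (fun x => φ x - m * ψ x) := by
        have hs : tsupport (fun x => φ x - m * ψ x) ⊆ tsupport φ ∪ tsupport ψ := by
          refine closure_minimal ?_ ((isClosed_tsupport φ).union (isClosed_tsupport ψ))
          intro x hx
          by_contra hh
          rw [mem_union, not_or] at hh
          apply hx
          simp [image_eq_zero_of_notMem_tsupport hh.1, image_eq_zero_of_notMem_tsupport hh.2]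
        exact ⟨hφ.smooth.sub (contDiff_const.mul hψ.smooth),
          (hφ.compact.isCompact.union hψ.compact.isCompact).of_isClosed_subset
            (isClosed_tsupport _) hs,
          hs.trans (union_subset hφ.subset hψ.subset)⟩
      obtain ⟨χ, hχ, hd⟩ := hη.primitive (by
        rw [integral_sub (hφ.smooth.continuous.integrable_of_hasCompactSupport hφ.compact)
          ((hψ.smooth.continuous.integrable_of_hasCompactSupport hψ.compact).const_mul m),
          integral_const_mul, hψ1, mul_one, sub_self])
      have e1 := hzero χ hχ
      rw [hd] at e1
      have e2 : ∀ x, (φ x - m * ψ x) • f x = φ x • f x - m • (ψ x • f x) := fun x => by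
        rw [sub_smul, mul_smul]
      simp only [e2] at e1
      rw [integral_sub (f.integrable_smul hφ.smooth.continuous hφ.compact)
        ((f.integrable_smul hψ.smooth.continuous hψ.compact).fun_smul m), integral_smul] at e1
      have e3 : ∀ x, φ x • (f x - c) = φ x • f x - φ x • c := fun x => smul_sub _ _ _
      simp only [e3]
      rw [integral_sub (f.integrable_smul hφ.smooth.continuous hφ.compact)
        ((hφ.smooth.continuous.integrable_of_hasCompactSupport hφ.compact).restrict.smul_const c),
        integral_smul_const, hm]
      exact e1)
  filter_upwards [h0] with x hx
  exact sub_eq_zero.1 hx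

/-- The Sobolev space `H^k(0, ℓ)`: the functions of `L²(0, ℓ)` whose weak derivatives up to
order `k` belong to `L²(0, ℓ)`. -/
def Sobolev (ℓ : ℝ) : ℕ → Submodule ℂ (L2 ℓ)
  | 0 => ⊤
  | k + 1 =>
    { carrier := {f | ∃ g ∈ Sobolev ℓ k, IsWeakDeriv f g}
      zero_mem' := ⟨0, zero_mem _, IsWeakDeriv.zero⟩
      add_mem' := by
        rintro f g ⟨f', hf', hf⟩ ⟨g', hg', hg⟩
        exact ⟨f' + g', add_mem hf' hg', hf.add hg⟩
      smul_mem' := by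
        rintro c f ⟨f', hf', hf⟩
        exact ⟨c • f', Submodule.smul_mem _ c hf', hf.smul c⟩ }

open Classical in
/-- The weak derivative `∂ₓ f` of `f ∈ H¹(0, ℓ)` (and `0` if `f` is not in `H¹(0, ℓ)`). -/
def wderiv {ℓ : ℝ} (f : L2 ℓ) : L2 ℓ :=
  if h : ∃ g, IsWeakDeriv f g then h.choose else 0

lemma IsWeakDeriv.wderiv_eq {ℓ : ℝ} {f g : L2 ℓ} (h : IsWeakDeriv f g) : wderiv f = g := by
  have h' : ∃ g, IsWeakDeriv f g := ⟨g, h⟩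
  rw [wderiv, dif_pos h']
  exact h'.choose_spec.unique h

lemma isWeakDeriv_wderiv {ℓ : ℝ} {k : ℕ} {f : L2 ℓ} (hf : f ∈ Sobolev ℓ (k + 1)) :
    IsWeakDeriv f (wderiv f) := by
  obtain ⟨g, -, h⟩ := hf
  rwa [h.wderiv_eq]

lemma wderiv_mem {ℓ : ℝ} {k : ℕ} {f : L2 ℓ} (hf : f ∈ Sobolev ℓ (k + 1)) :
    wderiv f ∈ Sobolev ℓ k := by
  obtain ⟨g, hg, h⟩ := hf
  rwa [h.wderiv_eq]

lemma wderiv_add {ℓ : ℝ} {k : ℕ} {f g : L2 ℓ} (hf : f ∈ Sobolev ℓ (k + 1))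
    (hg : g ∈ Sobolev ℓ (k + 1)) : wderiv (f + g) = wderiv f + wderiv g :=
  ((isWeakDeriv_wderiv hf).add (isWeakDeriv_wderiv hg)).wderiv_eq

lemma wderiv_smul {ℓ : ℝ} {k : ℕ} {f : L2 ℓ} (c : ℂ) (hf : f ∈ Sobolev ℓ (k + 1)) :
    wderiv (c • f) = c • wderiv f :=
  ((isWeakDeriv_wderiv hf).smul c).wderiv_eq

/-- The iterated weak derivative `∂ₓᵏ f`. -/
def wderivN {ℓ : ℝ} (k : ℕ) (f : L2 ℓ) : L2 ℓ := wderiv^[k] f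

lemma wderivN_add {ℓ : ℝ} (k : ℕ) {m : ℕ} {f g : L2 ℓ} (hf : f ∈ Sobolev ℓ (m + k))
    (hg : g ∈ Sobolev ℓ (m + k)) : wderivN k (f + g) = wderivN k f + wderivN k g := by
  induction k generalizing f g with
  | zero => rfl
  | succ k ih =>
    have := ih (wderiv_mem (k := m + k) hf) (wderiv_mem (k := m + k) hg)
    rw [← wderiv_add (k := m + k) hf hg] at this
    exact this

lemma wderivN_smul {ℓ : ℝ} (k : ℕ) {m : ℕ} {f : L2 ℓ} (c : ℂ) (hf : f ∈ Sobolev ℓ (m + k)) :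
    wderivN k (c • f) = c • wderivN k f := by
  induction k generalizing f with
  | zero => rfl
  | succ k ih =>
    have := ih (wderiv_mem (k := m + k) hf)
    rw [← wderiv_smul (k := m + k) c hf] at this
    exact this

lemma wderivN_zero {ℓ : ℝ} (k : ℕ) : wderivN k (0 : L2 ℓ) = 0 :=
  Function.iterate_fixed IsWeakDeriv.zero.wderiv_eq k

/-- `f(a) = c`, in the sense that `f` has a representative that is continuous on `[0, ℓ]` and
takes the value `c` at the point `a`. (Every `f ∈ H¹(0, ℓ)` has such a representative.) -/
def HasValueAt {ℓ : ℝ} (f : L2 ℓ) (a : ℝ) (c : ℂ) : Prop :=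
  ∃ F : ℝ → ℂ, ContinuousOn F (Icc 0 ℓ) ∧ f =ᵐ[volume.restrict (Ioo (0 : ℝ) ℓ)] F ∧ F a = c

lemma HasValueAt.zero {ℓ : ℝ} (a : ℝ) : HasValueAt (0 : L2 ℓ) a 0 :=
  ⟨0, continuousOn_const, Lp.coeFn_zero _ _ _, rfl⟩

lemma HasValueAt.add {ℓ : ℝ} {f g : L2 ℓ} {a : ℝ} {c d : ℂ} (hf : HasValueAt f a c)
    (hg : HasValueAt g a d) : HasValueAt (f + g) a (c + d) := by
  obtain ⟨F, hF, hfF, rfl⟩ := hf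
  obtain ⟨G, hG, hgG, rfl⟩ := hg
  refine ⟨F + G, hF.add hG, ?_, rfl⟩
  exact (Lp.coeFn_add f g).trans (hfF.add hgG)

lemma HasValueAt.smul {ℓ : ℝ} {f : L2 ℓ} {a : ℝ} {c : ℂ} (r : ℂ) (hf : HasValueAt f a c) :
    HasValueAt (r • f) a (r * c) := by
  obtain ⟨F, hF, hfF, rfl⟩ := hf
  refine ⟨r • F, hF.const_smul r, ?_, rfl⟩
  exact (Lp.coeFn_smul r f).trans (hfF.const_smul r)

lemma eq_zero_of_wderiv_eq_zero {ℓ : ℝ} (hℓ : 0 < ℓ) {k : ℕ} {f : L2 ℓ}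
    (hf : f ∈ Sobolev ℓ (k + 1)) (h0 : wderiv f = 0) {a : ℝ} (ha : a ∈ Icc 0 ℓ)
    (hv : HasValueAt f a 0) : f = 0 := by
  have h := isWeakDeriv_wderiv hf
  rw [h0] at h
  obtain ⟨c, hc⟩ := h.const_of_zero hℓ
  obtain ⟨F, hF, hfF, hFa⟩ := hv
  have hE : F =ᵐ[volume.restrict (Icc (0 : ℝ) ℓ)] fun _ => c := by
    rw [← restrict_Ioo_eq_restrict_Icc]
    exact hfF.symm.trans hc
  have := Measure.eqOn_Icc_of_ae_eq volume hℓ.ne hE hF continuousOn_const ha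
  have hc0 : c = 0 := this.symm.trans hFa
  refine Lp.ext ?_
  filter_upwards [hc, Lp.coeFn_zero ℂ 2 (volume.restrict (Ioo (0 : ℝ) ℓ))] with x h1 h2
  rw [h1, h2, hc0]
  rfl

/-! ## The string with Cattaneo heat conduction coupled to an elastic beam -/

/-- The lengths of the string and of the beam, and the positive constants of the system. -/
structure Params where
  (ℓ₁ ℓ₂ α₁ α₂ β₁ γ₁ δ₁ τ₁ κ₁ : ℝ)
  ℓ₁_pos : 0 < ℓ₁
  ℓ₂_pos : 0 < ℓ₂
  α₁_pos : 0 < α₁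
  α₂_pos : 0 < α₂
  β₁_pos : 0 < β₁
  γ₁_pos : 0 < γ₁
  δ₁_pos : 0 < δ₁
  τ₁_pos : 0 < τ₁
  κ₁_pos : 0 < κ₁

/-- The space `V` of the pairs `(f₁, f₂) ∈ H¹(0, ℓ₁) × H²(0, ℓ₂)` with `f₁(ℓ₁) = 0`,
`f₂(ℓ₂) = 0`, `f₁(0) = f₂(0)` and `∂ₓ f₂(0) = 0`. -/
def V (P : Params) : Submodule ℂ (L2 P.ℓ₁ × L2 P.ℓ₂) where
  carrier := {f | f.1 ∈ Sobolev P.ℓ₁ 1 ∧ f.2 ∈ Sobolev P.ℓ₂ 2 ∧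
    HasValueAt f.1 P.ℓ₁ 0 ∧ HasValueAt f.2 P.ℓ₂ 0 ∧
    (∃ c, HasValueAt f.1 0 c ∧ HasValueAt f.2 0 c) ∧
    HasValueAt (wderiv f.2) 0 0}
  zero_mem' := ⟨zero_mem _, zero_mem _, .zero _, .zero _, ⟨0, .zero _, .zero _⟩, by
    rw [Prod.snd_zero, IsWeakDeriv.zero.wderiv_eq]
    exact .zero _⟩
  add_mem' := by
    rintro f g ⟨f1, f2, f3, f4, ⟨c, f5, f6⟩, f7⟩ ⟨g1, g2, g3, g4, ⟨d, g5, g6⟩, g7⟩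
    refine ⟨add_mem f1 g1, add_mem f2 g2, ?_, ?_, ⟨c + d, f5.add g5, f6.add g6⟩, ?_⟩
    · simpa using f3.add g3
    · simpa using f4.add g4
    · rw [Prod.snd_add, wderiv_add f2 g2]
      simpa using f7.add g7
  smul_mem' := by
    rintro r f ⟨f1, f2, f3, f4, ⟨c, f5, f6⟩, f7⟩
    refine ⟨Submodule.smul_mem _ r f1, Submodule.smul_mem _ r f2, ?_, ?_,
      ⟨r * c, f5.smul r, f6.smul r⟩, ?_⟩
    · simpa using f3.smul r
    · simpa using f4.smul r
    · rw [Prod.smul_snd, wderiv_smul r f2]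
      simpa using f7.smul r

/-- The energy space `H₁ = V × (L²(0, ℓ₁) × L²(0, ℓ₂)) × L²(0, ℓ₁) × L²(0, ℓ₁)`. It is a type of
its own because it does not carry the product norm but the energy norm defined below. -/
def EnergySpace (P : Params) : Type :=
  V P × (L2 P.ℓ₁ × L2 P.ℓ₂) × L2 P.ℓ₁ × L2 P.ℓ₁

namespace EnergySpace

variable {P : Params}

instance : AddCommGroup (EnergySpace P) :=
  inferInstanceAs (AddCommGroup (V P × (L2 P.ℓ₁ × L2 P.ℓ₂) × L2 P.ℓ₁ × L2 P.ℓ₁))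

instance : Module ℂ (EnergySpace P) :=
  inferInstanceAs (Module ℂ (V P × (L2 P.ℓ₁ × L2 P.ℓ₂) × L2 P.ℓ₁ × L2 P.ℓ₁))

/-- The element `(u₁, u₂, v₁, v₂, θ₁, q₁)` of the energy space. -/
def mk (u : V P) (v₁ : L2 P.ℓ₁) (v₂ : L2 P.ℓ₂) (θ₁ q₁ : L2 P.ℓ₁) : EnergySpace P :=
  (u, (v₁, v₂), θ₁, q₁)

/-- The displacement of the string. -/
def u₁ (y : EnergySpace P) : L2 P.ℓ₁ := y.1.1.1
/-- The displacement of the beam. -/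
def u₂ (y : EnergySpace P) : L2 P.ℓ₂ := y.1.1.2
/-- The velocity of the string. -/
def v₁ (y : EnergySpace P) : L2 P.ℓ₁ := y.2.1.1
/-- The velocity of the beam. -/
def v₂ (y : EnergySpace P) : L2 P.ℓ₂ := y.2.1.2
/-- The temperature difference in the string. -/
def θ₁ (y : EnergySpace P) : L2 P.ℓ₁ := y.2.2.1
/-- The heat flux in the string. -/
def q₁ (y : EnergySpace P) : L2 P.ℓ₁ := y.2.2.2

@[simp] lemma u₁_mk (u : V P) (v₁ : L2 P.ℓ₁) (v₂ : L2 P.ℓ₂) (θ₁ q₁ : L2 P.ℓ₁) :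
    (mk u v₁ v₂ θ₁ q₁).u₁ = u.1.1 := rfl
@[simp] lemma u₂_mk (u : V P) (v₁ : L2 P.ℓ₁) (v₂ : L2 P.ℓ₂) (θ₁ q₁ : L2 P.ℓ₁) :
    (mk u v₁ v₂ θ₁ q₁).u₂ = u.1.2 := rfl
@[simp] lemma v₁_mk (u : V P) (v₁ : L2 P.ℓ₁) (v₂ : L2 P.ℓ₂) (θ₁ q₁ : L2 P.ℓ₁) :
    (mk u v₁ v₂ θ₁ q₁).v₁ = v₁ := rfl
@[simp] lemma v₂_mk (u : V P) (v₁ : L2 P.ℓ₁) (v₂ : L2 P.ℓ₂) (θ₁ q₁ : L2 P.ℓ₁) :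
    (mk u v₁ v₂ θ₁ q₁).v₂ = v₂ := rfl
@[simp] lemma θ₁_mk (u : V P) (v₁ : L2 P.ℓ₁) (v₂ : L2 P.ℓ₂) (θ₁ q₁ : L2 P.ℓ₁) :
    (mk u v₁ v₂ θ₁ q₁).θ₁ = θ₁ := rfl
@[simp] lemma q₁_mk (u : V P) (v₁ : L2 P.ℓ₁) (v₂ : L2 P.ℓ₂) (θ₁ q₁ : L2 P.ℓ₁) :
    (mk u v₁ v₂ θ₁ q₁).q₁ = q₁ := rfl
@[simp] lemma u₁_add (y z : EnergySpace P) : (y + z).u₁ = y.u₁ + z.u₁ := rfl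
@[simp] lemma u₂_add (y z : EnergySpace P) : (y + z).u₂ = y.u₂ + z.u₂ := rfl
@[simp] lemma v₁_add (y z : EnergySpace P) : (y + z).v₁ = y.v₁ + z.v₁ := rfl
@[simp] lemma v₂_add (y z : EnergySpace P) : (y + z).v₂ = y.v₂ + z.v₂ := rfl
@[simp] lemma θ₁_add (y z : EnergySpace P) : (y + z).θ₁ = y.θ₁ + z.θ₁ := rfl
@[simp] lemma q₁_add (y z : EnergySpace P) : (y + z).q₁ = y.q₁ + z.q₁ := rfl
@[simp] lemma u₁_smul (c : ℂ) (y : EnergySpace P) : (c • y).u₁ = c • y.u₁ := rfl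
@[simp] lemma u₂_smul (c : ℂ) (y : EnergySpace P) : (c • y).u₂ = c • y.u₂ := rfl
@[simp] lemma v₁_smul (c : ℂ) (y : EnergySpace P) : (c • y).v₁ = c • y.v₁ := rfl
@[simp] lemma v₂_smul (c : ℂ) (y : EnergySpace P) : (c • y).v₂ = c • y.v₂ := rfl
@[simp] lemma θ₁_smul (c : ℂ) (y : EnergySpace P) : (c • y).θ₁ = c • y.θ₁ := rfl
@[simp] lemma q₁_smul (c : ℂ) (y : EnergySpace P) : (c • y).q₁ = c • y.q₁ := rfl
@[simp] lemma u₁_zero : (0 : EnergySpace P).u₁ = 0 := rfl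
@[simp] lemma u₂_zero : (0 : EnergySpace P).u₂ = 0 := rfl
@[simp] lemma v₁_zero : (0 : EnergySpace P).v₁ = 0 := rfl
@[simp] lemma v₂_zero : (0 : EnergySpace P).v₂ = 0 := rfl
@[simp] lemma θ₁_zero : (0 : EnergySpace P).θ₁ = 0 := rfl
@[simp] lemma q₁_zero : (0 : EnergySpace P).q₁ = 0 := rfl

lemma u_mem (y : EnergySpace P) : (y.u₁, y.u₂) ∈ V P := y.1.2

lemma u₁_mem (y : EnergySpace P) : y.u₁ ∈ Sobolev P.ℓ₁ (0 + 1) := y.1.2.1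

lemma u₂_mem (y : EnergySpace P) : y.u₂ ∈ Sobolev P.ℓ₂ (0 + 2) := y.1.2.2.1

@[ext]
lemma ext {y z : EnergySpace P} (h1 : y.u₁ = z.u₁) (h2 : y.u₂ = z.u₂) (h3 : y.v₁ = z.v₁)
    (h4 : y.v₂ = z.v₂) (h5 : y.θ₁ = z.θ₁) (h6 : y.q₁ = z.q₁) : y = z :=
  Prod.ext (Subtype.ext (Prod.ext h1 h2)) (Prod.ext (Prod.ext h3 h4) (Prod.ext h5 h6))

/-- The inner product of the energy space, conjugate linear in the first argument; `inner ℂ` on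
the right-hand side is the inner product of `L²`. -/
def energyInner (y z : EnergySpace P) : ℂ :=
  ((P.δ₁ * P.α₁ / P.β₁ : ℝ) : ℂ) * inner ℂ (wderiv y.u₁) (wderiv z.u₁)
    + ((P.δ₁ / P.β₁ : ℝ) : ℂ) * inner ℂ y.v₁ z.v₁
    + inner ℂ y.θ₁ z.θ₁
    + ((P.γ₁ * P.τ₁ / P.κ₁ : ℝ) : ℂ) * inner ℂ y.q₁ z.q₁
    + (P.α₂ : ℂ) * inner ℂ (wderivN 2 y.u₂) (wderivN 2 z.u₂)
    + inner ℂ y.v₂ z.v₂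

lemma energyInner_self (y : EnergySpace P) :
    energyInner y y = ((P.δ₁ * P.α₁ / P.β₁ * ‖wderiv y.u₁‖ ^ 2 + P.δ₁ / P.β₁ * ‖y.v₁‖ ^ 2
      + ‖y.θ₁‖ ^ 2 + P.γ₁ * P.τ₁ / P.κ₁ * ‖y.q₁‖ ^ 2 + P.α₂ * ‖wderivN 2 y.u₂‖ ^ 2
      + ‖y.v₂‖ ^ 2 : ℝ) : ℂ) := by
  simp only [energyInner, inner_self_eq_norm_sq_to_K]
  push_cast
  rfl

/-- The energy inner product is a (definite) inner product. -/
@[reducible]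
def energyCore (P : Params) : InnerProductSpace.Core ℂ (EnergySpace P) where
  inner := energyInner
  conj_inner_symm y z := by
    simp only [energyInner, map_add, map_mul, Complex.conj_ofReal, inner_conj_symm]
  re_inner_nonneg y := by
    have := P.α₁_pos
    have := P.α₂_pos
    have := P.β₁_pos
    have := P.γ₁_pos
    have := P.δ₁_pos
    have := P.τ₁_pos
    have := P.κ₁_pos
    rw [energyInner_self, RCLike.re_eq_complex_re, Complex.ofReal_re]
    positivity
  add_left x y z := by
    simp only [energyInner, u₁_add, u₂_add, v₁_add, v₂_add, θ₁_add, q₁_add, inner_add_left,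
      wderiv_add x.u₁_mem y.u₁_mem, wderivN_add 2 x.u₂_mem y.u₂_mem]
    ring
  smul_left x y r := by
    simp only [energyInner, u₁_smul, u₂_smul, v₁_smul, v₂_smul, θ₁_smul, q₁_smul,
      inner_smul_left, wderiv_smul r x.u₁_mem, wderivN_smul 2 r x.u₂_mem]
    ring
  definite y h := by
    have a1 := P.α₁_pos
    have a2 := P.α₂_pos
    have b1 := P.β₁_pos
    have c1 := P.γ₁_pos
    have d1 := P.δ₁_pos
    have t1 := P.τ₁_pos
    have k1 := P.κ₁_pos
    rw [energyInner_self, Complex.ofReal_eq_zero] at h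
    have e1 : 0 ≤ P.δ₁ * P.α₁ / P.β₁ * ‖wderiv y.u₁‖ ^ 2 := by positivity
    have e2 : 0 ≤ P.δ₁ / P.β₁ * ‖y.v₁‖ ^ 2 := by positivity
    have e3 : 0 ≤ ‖y.θ₁‖ ^ 2 := by positivity
    have e4 : 0 ≤ P.γ₁ * P.τ₁ / P.κ₁ * ‖y.q₁‖ ^ 2 := by positivity
    have e5 : 0 ≤ P.α₂ * ‖wderivN 2 y.u₂‖ ^ 2 := by positivity
    have e6 : 0 ≤ ‖y.v₂‖ ^ 2 := by positivity
    have key : ∀ {E : Type} [NormedAddCommGroup E] {r : ℝ} (x : E), 0 < r →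
        r * ‖x‖ ^ 2 = 0 → x = 0 := by
      intro E _ r x hr hx
      rcases mul_eq_zero.1 hx with h | h
      · exact absurd h hr.ne'
      · exact norm_eq_zero.1 (pow_eq_zero_iff (two_ne_zero)|>.1 h)
    have z1 : wderiv y.u₁ = 0 := key _ (div_pos (mul_pos d1 a1) b1) (by linarith)
    have z2 : y.v₁ = 0 := key _ (div_pos d1 b1) (by linarith)
    have z3 : y.θ₁ = 0 := key _ one_pos (by linarith)
    have z4 : y.q₁ = 0 := key _ (div_pos (mul_pos c1 t1) k1) (by linarith)
    have z5 : wderiv (wderiv y.u₂) = 0 := key (wderivN 2 y.u₂) a2 (by linarith)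
    have z6 : y.v₂ = 0 := key _ one_pos (by linarith)
    obtain ⟨m1, m2, m3, m4, -, m6⟩ := y.u_mem
    have w1 : y.u₁ = 0 :=
      eq_zero_of_wderiv_eq_zero P.ℓ₁_pos m1 z1 (right_mem_Icc.2 P.ℓ₁_pos.le) m3
    have w2 : wderiv y.u₂ = 0 :=
      eq_zero_of_wderiv_eq_zero P.ℓ₂_pos (wderiv_mem m2) z5 (left_mem_Icc.2 P.ℓ₂_pos.le) m6
    have w3 : y.u₂ = 0 :=
      eq_zero_of_wderiv_eq_zero P.ℓ₂_pos m2 w2 (right_mem_Icc.2 P.ℓ₂_pos.le) m4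
    exact EnergySpace.ext w1 w3 z2 z6 z3 z4

instance : NormedAddCommGroup (EnergySpace P) :=
  (energyCore P).toNormedAddCommGroup

instance : InnerProductSpace ℂ (EnergySpace P) :=
  InnerProductSpace.ofCore (energyCore P).toCore

lemma inner_eq (y z : EnergySpace P) : inner ℂ y z = energyInner y z := rfl

lemma norm_sq_eq (y : EnergySpace P) :
    ‖y‖ ^ 2 = P.δ₁ * P.α₁ / P.β₁ * ‖wderiv y.u₁‖ ^ 2 + P.δ₁ / P.β₁ * ‖y.v₁‖ ^ 2
      + ‖y.θ₁‖ ^ 2 + P.γ₁ * P.τ₁ / P.κ₁ * ‖y.q₁‖ ^ 2 + P.α₂ * ‖wderivN 2 y.u₂‖ ^ 2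
      + ‖y.v₂‖ ^ 2 := by
  rw [@norm_sq_eq_re_inner ℂ, inner_eq, energyInner_self]
  rfl

end EnergySpace

/-- The domain `D(A₁)`: all `y = (u, v, θ₁, q₁)` with `u ∈ V ∩ (H²(0, ℓ₁) × H⁴(0, ℓ₂))`, `v ∈ V`,
`θ₁ ∈ H¹₀(0, ℓ₁)`, `q₁ ∈ H¹(0, ℓ₁)`, `∂ₓ² u₂(ℓ₂) = 0` and
`α₂ ∂ₓ³ u₂(0) = (δ₁ / β₁) α₁ ∂ₓ u₁(0)`. That `u ∈ V` is part of the type of `y`. -/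
def domA (P : Params) : Submodule ℂ (EnergySpace P) where
  carrier := {y | y.u₁ ∈ Sobolev P.ℓ₁ 2 ∧ y.u₂ ∈ Sobolev P.ℓ₂ 4 ∧ (y.v₁, y.v₂) ∈ V P ∧
    (y.θ₁ ∈ Sobolev P.ℓ₁ 1 ∧ HasValueAt y.θ₁ 0 0 ∧ HasValueAt y.θ₁ P.ℓ₁ 0) ∧
    y.q₁ ∈ Sobolev P.ℓ₁ 1 ∧
    HasValueAt (wderivN 2 y.u₂) P.ℓ₂ 0 ∧
    ∃ a b : ℂ, HasValueAt (wderivN 3 y.u₂) 0 a ∧ HasValueAt (wderiv y.u₁) 0 b ∧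
      (P.α₂ : ℂ) * a = ((P.δ₁ / P.β₁ * P.α₁ : ℝ) : ℂ) * b}
  zero_mem' := by
    refine ⟨zero_mem _, zero_mem _, zero_mem (V P), ⟨zero_mem _, .zero _, .zero _⟩, zero_mem _,
      ?_, 0, 0, ?_, ?_, by simp⟩
    · rw [EnergySpace.u₂_zero, wderivN_zero]
      exact .zero _
    · rw [EnergySpace.u₂_zero, wderivN_zero]
      exact .zero _
    · rw [EnergySpace.u₁_zero, IsWeakDeriv.zero.wderiv_eq]
      exact .zero _
  add_mem' := by
    rintro y z ⟨y1, y2, y3, ⟨y4, y5, y6⟩, y7, y8, a, b, y9, y10, y11⟩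
      ⟨z1, z2, z3, ⟨z4, z5, z6⟩, z7, z8, c, d, z9, z10, z11⟩
    refine ⟨add_mem y1 z1, add_mem y2 z2, add_mem (S := Submodule ℂ (L2 P.ℓ₁ × L2 P.ℓ₂)) y3 z3,
      ⟨add_mem y4 z4, ?_, ?_⟩, add_mem y7 z7, ?_, a + c, b + d, ?_, ?_, ?_⟩
    · simpa using y5.add z5
    · simpa using y6.add z6
    · rw [EnergySpace.u₂_add, wderivN_add (m := 2) 2 y2 z2]
      simpa using y8.add z8
    · rw [EnergySpace.u₂_add, wderivN_add (m := 1) 3 y2 z2]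
      exact y9.add z9
    · rw [EnergySpace.u₁_add, wderiv_add y1 z1]
      exact y10.add z10
    · rw [mul_add, y11, z11, mul_add]
  smul_mem' := by
    rintro r y ⟨y1, y2, y3, ⟨y4, y5, y6⟩, y7, y8, a, b, y9, y10, y11⟩
    refine ⟨Submodule.smul_mem _ r y1, Submodule.smul_mem _ r y2, Submodule.smul_mem (V P) r y3,
      ⟨Submodule.smul_mem _ r y4, ?_, ?_⟩, Submodule.smul_mem _ r y7, ?_, r * a, r * b, ?_, ?_, ?_⟩
    · simpa using y5.smul r
    · simpa using y6.smul r
    · rw [EnergySpace.u₂_smul, wderivN_smul (m := 2) 2 r y2]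
      simpa using y8.smul r
    · rw [EnergySpace.u₂_smul, wderivN_smul (m := 1) 3 r y2]
      exact y9.smul r
    · rw [EnergySpace.u₁_smul, wderiv_smul r y1]
      exact y10.smul r
    · rw [mul_left_comm, y11, mul_left_comm]

lemma domA.v_mem {P : Params} {y : EnergySpace P} (hy : y ∈ domA P) : (y.v₁, y.v₂) ∈ V P :=
  hy.2.2.1

/-- The value `A₁ y` at a point `y = (u₁, u₂, v₁, v₂, θ₁, q₁)` of the domain. -/
def opAFun {P : Params} (y : domA P) : EnergySpace P :=
  EnergySpace.mk
    (⟨(y.1.v₁, y.1.v₂), domA.v_mem y.2⟩ : V P)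
    ((P.α₁ : ℂ) • wderivN 2 y.1.u₁ - (P.β₁ : ℂ) • wderiv y.1.θ₁)
    (-((P.α₂ : ℂ) • wderivN 4 y.1.u₂))
    (-((P.γ₁ : ℂ) • wderiv y.1.q₁) - (P.δ₁ : ℂ) • wderiv y.1.v₁)
    (-(((1 / P.τ₁ : ℝ) : ℂ) • y.1.q₁) - ((P.κ₁ / P.τ₁ : ℝ) : ℂ) • wderiv y.1.θ₁)

/-- The unbounded operator `A₁` on the energy space, with domain `D(A₁)`. -/
def opA (P : Params) : EnergySpace P →ₗ.[ℂ] EnergySpace P where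
  domain := domA P
  toFun :=
    { toFun := opAFun
      map_add' := by
        rintro ⟨y, hy⟩ ⟨z, hz⟩
        obtain ⟨y1, y2, y3, ⟨y4, -, -⟩, y7, -⟩ := id hy
        obtain ⟨z1, z2, z3, ⟨z4, -, -⟩, z7, -⟩ := id hz
        have e1 := wderivN_add (m := 0) 2 y1 z1
        have e2 := wderivN_add (m := 0) 4 y2 z2
        have e3 := wderiv_add y3.1 z3.1
        have e4 := wderiv_add y4 z4
        have e5 := wderiv_add y7 z7
        simp only at e3
        apply EnergySpace.ext <;>
          simp only [opAFun, AddMemClass.mk_add_mk, EnergySpace.u₁_mk, EnergySpace.u₂_mk,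
            EnergySpace.v₁_mk, EnergySpace.v₂_mk, EnergySpace.θ₁_mk, EnergySpace.q₁_mk,
            EnergySpace.u₁_add, EnergySpace.u₂_add, EnergySpace.v₁_add, EnergySpace.v₂_add,
            EnergySpace.θ₁_add, EnergySpace.q₁_add, e1, e2, e3, e4, e5] <;>
          module
      map_smul' := by
        rintro r ⟨y, hy⟩
        obtain ⟨y1, y2, y3, ⟨y4, -, -⟩, y7, -⟩ := id hy
        have e1 := wderivN_smul (m := 0) 2 r y1
        have e2 := wderivN_smul (m := 0) 4 r y2
        have e3 := wderiv_smul r y3.1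
        have e4 := wderiv_smul r y4
        have e5 := wderiv_smul r y7
        simp only at e3
        apply EnergySpace.ext <;>
          simp only [opAFun, SetLike.mk_smul_mk, RingHom.id_apply, EnergySpace.u₁_mk,
            EnergySpace.u₂_mk,
            EnergySpace.v₁_mk, EnergySpace.v₂_mk, EnergySpace.θ₁_mk, EnergySpace.q₁_mk,
            EnergySpace.u₁_smul, EnergySpace.u₂_smul, EnergySpace.v₁_smul, EnergySpace.v₂_smul,
            EnergySpace.θ₁_smul, EnergySpace.q₁_smul, e1, e2, e3, e4, e5] <;>
          module }

/-! ## Strongly continuous semigroups -/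

/-- A `C₀`-semigroup of bounded linear operators on a complex normed space. -/
structure C0Semigroup (X : Type*) [NormedAddCommGroup X] [NormedSpace ℂ X] where
  /-- the operators `S(t)`, `t ≥ 0` -/
  S : ℝ≥0 → X →L[ℂ] X
  S_zero : S 0 = ContinuousLinearMap.id ℂ X
  S_add : ∀ s t, S (s + t) = (S s).comp (S t)
  tendsto_zero : ∀ x, Tendsto (fun t => S t x) (𝓝[>] 0) (𝓝 x)

/-- `A` is the infinitesimal generator of the semigroup: `x ∈ D(A)` if and only if
`(S(t) x - x) / t` converges as `t → 0⁺`, and the limit is then `A x`. -/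
def C0Semigroup.IsGenerator {X : Type*} [NormedAddCommGroup X] [NormedSpace ℂ X]
    (T : C0Semigroup X) (A : X →ₗ.[ℂ] X) : Prop :=
  ∀ x z : X, (∃ hx : x ∈ A.domain, A ⟨x, hx⟩ = z) ↔
    Tendsto (fun t : ℝ≥0 => (((t : ℝ) : ℂ))⁻¹ • (T.S t x - x)) (𝓝[>] 0) (𝓝 z)

end StringBeam

end

/-!
The operator `A₁` is invertible, and everything is derived from its inverse `B`, which is a compact
operator.

Equation `A₁ y = F` is solved by successive integrations: `q₁` and `θ₁` come first, the constant
in `q₁` being fixed by `θ₁(ℓ₁) = 0`, and then `∂ₓ u₁` and `∂ₓ³ u₂`, whose constants are proportional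
by the transmission condition on the stresses and fixed by `u₁(0) = u₂(0)`; the determinant of this
last scalar equation is positive. In the coordinates `(∂ₓ u₁, ∂ₓ² u₂, v₁, v₂, θ₁, q₁)`, which
identify the energy space with a closed hyperplane of a product of `L²`-spaces, the solution
operator is built from the primitive operator `J` of `L²(0, ℓ)` and operators of rank one. As `J`
is compact by Arzelà-Ascoli, so is `B` (`isCompactOperator_inverseA`), and the same coordinates show
that the energy space is complete. Integration by parts in `H¹(0, ℓ)`, which follows from the
identity `⟪J f, g⟫ + ⟪f, J g⟫ = conj (∫ f) ∫ g`, gives `Re ⟪y, A₁ y⟫ = -(γ₁ / κ₁) ‖q₁‖²`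
(`re_inner_opA`).

Generation is proved for the inverse of any injective bounded operator `B` of a Hilbert space with
`Re ⟪z, B z⟫ ≤ 0`. The Yosida approximations of `B⁻¹` are the bounded dissipative operators
`(B - ε)⁻¹`; their exponentials are contractions which converge on the range of `B²`, hence
everywhere, and the limit satisfies `S(t) B z = B z + ∫₀ᵗ S(s) z ds`. This identity shows that
`B⁻¹` is contained in the generator, and, since `B` commutes with `S(t)`, that it is the generator
(`tendsto_inv_smul_semigroupOp_sub_iff`).

For strong stability let `M` be the closed subspace on which all `S(t)` are isometric. For `z ∈ M`
the function `‖S(t) B z‖²` is affine with slope `2 Re ⟪z, B z⟫`; being bounded, it is constant. So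
`B` maps `M` into itself and `i B` is symmetric on `M`. By the spectral theorem for compact
symmetric operators, `M` vanishes as soon as `B` has no nonzero imaginary eigenvalue. The orbit of a
point of the range of `B` is relatively compact, its limit points belong to `M`, so it tends to `0`
(`tendsto_norm_semigroupOp`).

An eigenvector of `A₁` for an imaginary eigenvalue dissipates no energy, so `q₁`, then `θ₁`, then
`v₁` and `u₁` vanish. What remains is a fourth-order equation for `u₂` with three conditions at
`0` and two at `ℓ₂`, which forces `u₂ = 0` (`beam_eq_zero`).
-/

noncomputable section

namespace StringBeam

section Abstract

variable {H : Type*} [NormedAddCommGroup H] [InnerProductSpace ℂ H] [CompleteSpace H]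

set_option linter.unusedSectionVars false

/-! ### Exponentials of bounded dissipative operators -/

lemma hasDerivAt_exp_smul_apply (A : H →L[ℂ] H) (x : H) (t : ℝ) :
    HasDerivAt (fun s : ℝ => NormedSpace.exp (s • A) x) (NormedSpace.exp (t • A) (A x)) t :=
  ((ContinuousLinearMap.apply ℂ H x).restrictScalars ℝ).hasFDerivAt.comp_hasDerivAt t
    (hasDerivAt_exp_smul_const A t)

lemma hasDerivAt_norm_sq {f : ℝ → H} {f' : H} {t : ℝ} (hf : HasDerivAt f f' t) :
    HasDerivAt (fun s => ‖f s‖ ^ 2) (2 * (inner ℂ (f t) f').re) t := by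
  have h := Complex.reCLM.hasFDerivAt.comp_hasDerivAt t (hf.inner ℂ hf)
  have e : (fun s => ‖f s‖ ^ 2) = Complex.reCLM ∘ fun s => inner ℂ (f s) (f s) := by
    funext s
    exact norm_sq_eq_re_inner (𝕜 := ℂ) (f s)
  rw [e]
  refine h.congr_deriv ?_
  rw [Complex.reCLM_apply, Complex.add_re, ← inner_conj_symm f' (f t), Complex.conj_re]
  ring

lemma commute_exp_smul {A C : H →L[ℂ] H} (h : Commute A C) (t : ℝ) :
    Commute (NormedSpace.exp (t • A)) C := by
  refine Commute.exp_left (Commute.smul_left h t)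

/-- The exponential of a bounded dissipative operator is a contraction: the squared norm of an
orbit has a nonpositive derivative. -/
lemma norm_exp_smul_apply_le {A : H →L[ℂ] H} (hA : ∀ x, (inner ℂ x (A x)).re ≤ 0) {t : ℝ}
    (ht : 0 ≤ t) (x : H) : ‖NormedSpace.exp (t • A) x‖ ≤ ‖x‖ := by
  have hd : ∀ s : ℝ, HasDerivAt (fun s : ℝ => ‖NormedSpace.exp (s • A) x‖ ^ 2)
      (2 * (inner ℂ (NormedSpace.exp (s • A) x) (NormedSpace.exp (s • A) (A x))).re) s :=
    fun s => hasDerivAt_norm_sq (hasDerivAt_exp_smul_apply A x s)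
  have hanti : Antitone (fun s : ℝ => ‖NormedSpace.exp (s • A) x‖ ^ 2) := by
    refine antitone_of_deriv_nonpos (fun s => (hd s).differentiableAt) fun s => ?_
    rw [(hd s).deriv]
    have hc : NormedSpace.exp (s • A) (A x) = A (NormedSpace.exp (s • A) x) :=
      DFunLike.congr_fun (commute_exp_smul (Commute.refl A) s).eq x
    rw [hc]
    have := hA (NormedSpace.exp (s • A) x)
    linarith
  have h := hanti ht
  simp only [zero_smul, NormedSpace.exp_zero, one_apply_eq_self] at h
  exact le_of_sq_le_sq h (norm_nonneg _)

/-- The difference of the two orbits is the integral of the derivative of the interpolating curve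
`s ↦ exp (s A) exp ((t - s) C) x`. -/
lemma norm_exp_smul_sub_exp_smul_le {A C : H →L[ℂ] H} (hA : ∀ x, (inner ℂ x (A x)).re ≤ 0)
    (hC : ∀ x, (inner ℂ x (C x)).re ≤ 0) (hAC : Commute A C) {t : ℝ} (ht : 0 ≤ t) (x : H) :
    ‖NormedSpace.exp (t • A) x - NormedSpace.exp (t • C) x‖ ≤ t * ‖A x - C x‖ := by
  have hd : ∀ s : ℝ, HasDerivAt
      (fun s : ℝ => (NormedSpace.exp (s • A) * NormedSpace.exp ((t - s) • C)) x)
      ((NormedSpace.exp (s • A) * NormedSpace.exp ((t - s) • C)) (A x - C x)) s := by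
    intro s
    have h1 := hasDerivAt_exp_smul_const A s
    have h2 := (hasDerivAt_exp_smul_const C (t - s)).scomp s ((hasDerivAt_id s).const_sub t)
    have h3 := ((ContinuousLinearMap.apply ℂ H x).restrictScalars ℝ).hasFDerivAt.comp_hasDerivAt s
      (h1.mul h2)
    refine h3.congr_deriv ?_
    have e : (NormedSpace.exp (s • A) * A) * NormedSpace.exp ((t - s) • C)
        = NormedSpace.exp (s • A) * (NormedSpace.exp ((t - s) • C) * A) := by
      rw [mul_assoc, (commute_exp_smul hAC.symm (t - s)).eq]
    simp only [ContinuousLinearMap.coe_restrictScalars', ContinuousLinearMap.apply_apply,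
      Function.comp_apply, e]
    simp [sub_eq_add_neg]
  have hb := norm_image_sub_le_of_norm_deriv_le_segment' (a := 0) (b := t) (C := ‖A x - C x‖)
    (fun s _ => (hd s).hasDerivWithinAt) (fun s hs =>
      (norm_exp_smul_apply_le hA hs.1 _).trans
        (norm_exp_smul_apply_le hC (sub_nonneg.2 hs.2.le) _)) t (right_mem_Icc.2 ht)
  simp only [sub_self, zero_smul, NormedSpace.exp_zero, mul_one, sub_zero, one_mul] at hb
  rwa [mul_comm] at hb

/-! ### The Yosida approximation in terms of the inverse of the generator -/

/-- `B` is the bounded inverse of a dissipative operator: it is injective and `Re ⟪z, B z⟫ ≤ 0`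
for all `z`. The operator itself is the inverse of `B`, defined on the range of `B`. -/
structure IsDissipativeInverse (B : H →L[ℂ] H) : Prop where
  injective : Function.Injective B
  re_inner_nonpos : ∀ z, (inner ℂ z (B z)).re ≤ 0

/-- The Yosida approximation `A (1 - ε A)⁻¹ = (B - ε)⁻¹` of `A = B⁻¹`. For `ε > 0` the operator
`B - ε` is invertible, so that `Ring.inverse` is its inverse. -/
def yosida (B : H →L[ℂ] H) (ε : ℝ) : H →L[ℂ] H := Ring.inverse (B - (ε : ℂ) • 1)

namespace IsDissipativeInverse

variable {B : H →L[ℂ] H}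

lemma re_inner_sub_smul_le (hB : IsDissipativeInverse B) (ε : ℝ) (x : H) :
    (inner ℂ ((B - (ε : ℂ) • (1 : H →L[ℂ] H)) x) x).re ≤ -(ε * ‖x‖ ^ 2) := by
  have h1 := hB.re_inner_nonpos x
  have h2 : (inner ℂ x x : ℂ) = ((‖x‖ ^ 2 : ℝ) : ℂ) := by
    rw [inner_self_eq_norm_sq_to_K]
    push_cast
    rfl
  rw [sub_apply, inner_sub_left, smul_apply, one_apply_eq_self, inner_smul_left, h2,
    ← inner_conj_symm, Complex.conj_ofReal,
    ← Complex.ofReal_mul, Complex.sub_re, Complex.conj_re, Complex.ofReal_re]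
  linarith

/-- `ε - B` is coercive, hence invertible. -/
lemma isUnit_sub_smul (hB : IsDissipativeInverse B) {ε : ℝ} (hε : 0 < ε) :
    IsUnit (B - (ε : ℂ) • (1 : H →L[ℂ] H)) := by
  refine ContinuousLinearMap.isUnit_of_forall_le_norm_inner_map _ (c := ⟨ε, hε.le⟩) hε fun x => ?_
  have h := hB.re_inner_sub_smul_le ε x
  have h2 := (abs_le.1 (Complex.abs_re_le_norm
    (inner ℂ ((B - (ε : ℂ) • (1 : H →L[ℂ] H)) x) x))).1
  change ‖x‖ ^ 2 * ε ≤ _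
  linarith

lemma apply_yosida (hB : IsDissipativeInverse B) {ε : ℝ} (hε : 0 < ε) (x : H) :
    B (yosida B ε x) = x + (ε : ℂ) • yosida B ε x := by
  have h := DFunLike.congr_fun (Ring.mul_inverse_cancel _ (hB.isUnit_sub_smul hε)) x
  simpa [yosida, sub_eq_iff_eq_add] using h

lemma yosida_apply (hB : IsDissipativeInverse B) {ε : ℝ} (hε : 0 < ε) (x : H) :
    yosida B ε (B x) = x + (ε : ℂ) • yosida B ε x := by
  have h := DFunLike.congr_fun (Ring.inverse_mul_cancel _ (hB.isUnit_sub_smul hε)) x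
  simpa [yosida, sub_eq_iff_eq_add] using h

lemma commute_yosida_self (hB : IsDissipativeInverse B) {ε : ℝ} (hε : 0 < ε) :
    Commute (yosida B ε) B := by
  ext x
  exact (hB.yosida_apply hε x).trans (hB.apply_yosida hε x).symm

lemma commute_yosida (hB : IsDissipativeInverse B) {ε η : ℝ} (hε : 0 < ε) (hη : 0 < η) :
    Commute (yosida B ε) (yosida B η) := by
  have h : Commute (yosida B ε) (B - (η : ℂ) • (1 : H →L[ℂ] H)) :=
    (hB.commute_yosida_self hε).sub_right ((Commute.one_right _).smul_right _)
  obtain ⟨u, hu⟩ := hB.isUnit_sub_smul hη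
  rw [← hu] at h
  rw [show yosida B η = Ring.inverse (u : H →L[ℂ] H) by rw [hu, yosida], Ring.inverse_unit]
  exact h.units_inv_right

lemma re_inner_yosida_nonpos (hB : IsDissipativeInverse B) {ε : ℝ} (hε : 0 < ε) (x : H) :
    (inner ℂ x (yosida B ε x)).re ≤ -(ε * ‖yosida B ε x‖ ^ 2) := by
  have h := hB.re_inner_sub_smul_le ε (yosida B ε x)
  have e : (B - (ε : ℂ) • (1 : H →L[ℂ] H)) (yosida B ε x) = x :=
    DFunLike.congr_fun (Ring.mul_inverse_cancel _ (hB.isUnit_sub_smul hε)) x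
  rwa [e] at h

lemma norm_smul_yosida_le (hB : IsDissipativeInverse B) {ε : ℝ} (hε : 0 < ε) (x : H) :
    ε * ‖yosida B ε x‖ ≤ ‖x‖ := by
  have h := hB.re_inner_yosida_nonpos hε x
  have h2 := (abs_le.1 (Complex.abs_re_le_norm (inner ℂ x (yosida B ε x)))).1
  have h3 := norm_inner_le_norm (𝕜 := ℂ) x (yosida B ε x)
  rcases (norm_nonneg (yosida B ε x)).eq_or_lt with h0 | h0
  · rw [← h0, mul_zero]
    exact norm_nonneg x
  · refine le_of_mul_le_mul_right ?_ h0
    nlinarith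

lemma norm_yosida_sub_le (hB : IsDissipativeInverse B) {ε : ℝ} (hε : 0 < ε) (w : H) :
    ‖yosida B ε (B (B w)) - B w‖ ≤ 2 * ε * ‖w‖ := by
  rw [hB.yosida_apply hε, add_sub_cancel_left, hB.yosida_apply hε, norm_smul, Complex.norm_real,
    Real.norm_of_nonneg hε.le]
  have h1 := norm_add_le w ((ε : ℂ) • yosida B ε w)
  rw [norm_smul, Complex.norm_real, Real.norm_of_nonneg hε.le] at h1
  have h2 := hB.norm_smul_yosida_le hε w
  nlinarith

/-- The domain of a dissipative operator with bounded inverse is dense: if `w` is orthogonal to the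
range of `B`, then the form `Re ⟪z, B z⟫ ≤ 0` vanishes at `w`, hence is stationary there. -/
lemma denseRange (hB : IsDissipativeInverse B) : DenseRange B := by
  have h : (B.range)ᗮ = ⊥ := by
    rw [Submodule.eq_bot_iff]
    intro w hw
    have hw' : ∀ x, inner ℂ w (B x) = 0 := fun x =>
      Submodule.inner_left_of_mem_orthogonal (K := B.range) ⟨x, rfl⟩ hw
    -- the form at `B w + r w` is at most `0` for all real `r`
    have key : ∀ r : ℝ, (inner ℂ (B w) (B (B w))).re + r * ‖B w‖ ^ 2 ≤ 0 := by
      intro r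
      have h1 := hB.re_inner_nonpos (B w + (r : ℂ) • w)
      rw [map_add, map_smul, inner_add_left, inner_smul_left, inner_add_right, inner_add_right,
        hw', inner_smul_right, inner_smul_right, hw', inner_self_eq_norm_sq_to_K] at h1
      simp only [mul_zero, add_zero, Complex.add_re] at h1
      have e : ((r : ℂ) * ((‖B w‖ : ℝ) : ℂ) ^ 2).re = r * ‖B w‖ ^ 2 := by
        rw [← Complex.ofReal_pow, ← Complex.ofReal_mul, Complex.ofReal_re]
      change _ + ((r : ℂ) * ((‖B w‖ : ℝ) : ℂ) ^ 2).re ≤ 0 at h1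
      rwa [e] at h1
    have hz : ‖B w‖ ^ 2 = 0 := by
      by_contra hne
      have h2 := key ((1 - (inner ℂ (B w) (B (B w))).re) / ‖B w‖ ^ 2)
      rw [div_mul_cancel₀ _ hne] at h2
      linarith
    have hBw : B w = 0 := norm_eq_zero.1 (pow_eq_zero_iff two_ne_zero |>.1 hz)
    exact hB.injective (by rw [hBw, map_zero])
  rw [DenseRange, dense_iff_closure_eq]
  have h2 := Submodule.topologicalClosure_eq_top_iff.2 h
  have h3 : closure ((B.range : Submodule ℂ H) : Set H) = univ :=
    congrArg (fun K : Submodule ℂ H => (K : Set H)) h2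
  exact h3

end IsDissipativeInverse

end Abstract

section Generation

variable {H : Type*} [NormedAddCommGroup H] [InnerProductSpace ℂ H] [CompleteSpace H]

set_option linter.unusedSectionVars false

/-! ### The semigroup generated by a dissipative operator with bounded inverse -/

/-- The contraction semigroup `exp (t (B - 1 / (n + 1))⁻¹)` generated by a Yosida approximation. -/
def yosidaExp (B : H →L[ℂ] H) (n : ℕ) (t : ℝ≥0) : H →L[ℂ] H :=
  NormedSpace.exp ((t : ℝ) • yosida B (1 / ((n : ℝ) + 1)))

namespace IsDissipativeInverse

variable {B : H →L[ℂ] H}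

lemma re_inner_yosida_nonpos' (hB : IsDissipativeInverse B) {ε : ℝ} (hε : 0 < ε) (x : H) :
    (inner ℂ x (yosida B ε x)).re ≤ 0 :=
  (hB.re_inner_yosida_nonpos hε x).trans (neg_nonpos.2 (by positivity))

lemma norm_yosidaExp_le (hB : IsDissipativeInverse B) (n : ℕ) (t : ℝ≥0) (x : H) :
    ‖yosidaExp B n t x‖ ≤ ‖x‖ :=
  norm_exp_smul_apply_le (hB.re_inner_yosida_nonpos' Nat.one_div_pos_of_nat) t.2 x

lemma yosidaExp_apply_comm (hB : IsDissipativeInverse B) (n : ℕ) (t : ℝ≥0) (x : H) :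
    yosidaExp B n t (B x) = B (yosidaExp B n t x) :=
  DFunLike.congr_fun (commute_exp_smul (hB.commute_yosida_self Nat.one_div_pos_of_nat) t).eq x

/-- The approximating semigroups converge on the dense range of `B²`, hence everywhere. -/
lemma cauchySeq_yosidaExp (hB : IsDissipativeInverse B) (t : ℝ≥0) (x : H) :
    CauchySeq fun n => yosidaExp B n t x := by
  have hdense : DenseRange (B ∘ B) := hB.denseRange.comp hB.denseRange B.continuous
  rw [Metric.cauchySeq_iff']
  intro δ hδ
  obtain ⟨w, hw⟩ := hdense.exists_dist_lt x (ε := δ / 4) (by positivity)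
  have hlim : Tendsto (fun n : ℕ => (t : ℝ) * (4 * ‖w‖) * (1 / ((n : ℝ) + 1))) atTop (𝓝 0) := by
    simpa using (tendsto_one_div_add_atTop_nhds_zero_nat (𝕜 := ℝ)).const_mul
      ((t : ℝ) * (4 * ‖w‖))
  obtain ⟨N, hN⟩ := (hlim.eventually (gt_mem_nhds (show (0 : ℝ) < δ / 4 by positivity))).exists
  refine ⟨N, fun n hn => ?_⟩
  have en : (0 : ℝ) < 1 / ((n : ℝ) + 1) := Nat.one_div_pos_of_nat
  have eN : (0 : ℝ) < 1 / ((N : ℝ) + 1) := Nat.one_div_pos_of_nat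
  have hle : 1 / ((n : ℝ) + 1) ≤ 1 / ((N : ℝ) + 1) := Nat.one_div_le_one_div hn
  have h1 : ‖yosidaExp B n t (B (B w)) - yosidaExp B N t (B (B w))‖ ≤ δ / 4 := by
    refine (norm_exp_smul_sub_exp_smul_le (hB.re_inner_yosida_nonpos' en)
      (hB.re_inner_yosida_nonpos' eN) (hB.commute_yosida en eN) t.2 _).trans
        (le_trans ?_ hN.le)
    have a1 := hB.norm_yosida_sub_le en w
    have a2 := hB.norm_yosida_sub_le eN w
    have a3 := norm_sub_le_norm_sub_add_norm_sub (yosida B (1 / ((n : ℝ) + 1)) (B (B w))) (B w)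
      (yosida B (1 / ((N : ℝ) + 1)) (B (B w)))
    rw [norm_sub_rev (B w)] at a3
    have a4 : 2 * (1 / ((n : ℝ) + 1)) * ‖w‖ ≤ 2 * (1 / ((N : ℝ) + 1)) * ‖w‖ := by gcongr
    rw [mul_assoc]
    refine mul_le_mul_of_nonneg_left ?_ t.2
    linarith
  have h2 : ∀ m, ‖yosidaExp B m t x - yosidaExp B m t (B (B w))‖ < δ / 4 := by
    intro m
    rw [← map_sub]
    refine (hB.norm_yosidaExp_le m t _).trans_lt ?_
    rw [← dist_eq_norm]
    exact hw
  rw [dist_eq_norm]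
  have e : yosidaExp B n t x - yosidaExp B N t x
      = (yosidaExp B n t x - yosidaExp B n t (B (B w)))
        + (yosidaExp B n t (B (B w)) - yosidaExp B N t (B (B w)))
        - (yosidaExp B N t x - yosidaExp B N t (B (B w))) := by abel
  rw [e]
  have b1 := norm_sub_le ((yosidaExp B n t x - yosidaExp B n t (B (B w)))
        + (yosidaExp B n t (B (B w)) - yosidaExp B N t (B (B w))))
        (yosidaExp B N t x - yosidaExp B N t (B (B w)))
  have b2 := norm_add_le (yosidaExp B n t x - yosidaExp B n t (B (B w)))
        (yosidaExp B n t (B (B w)) - yosidaExp B N t (B (B w)))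
  have b3 := h2 n
  have b4 := h2 N
  linarith

/-- The operators `S(t)` of the semigroup generated by `B⁻¹`: the strong limits of the
approximating semigroups. -/
def semigroupOp (hB : IsDissipativeInverse B) (t : ℝ≥0) : H →L[ℂ] H :=
  LinearMap.mkContinuous
    { toFun := fun x => limUnder atTop fun n => yosidaExp B n t x
      map_add' := fun x y => by
        have h := (hB.cauchySeq_yosidaExp t x).tendsto_limUnder.add
          (hB.cauchySeq_yosidaExp t y).tendsto_limUnder
        simp only [← map_add] at h
        exact h.limUnder_eq
      map_smul' := fun c x => by
        have h := (hB.cauchySeq_yosidaExp t x).tendsto_limUnder.const_smul c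
        simp only [← map_smul] at h
        exact h.limUnder_eq }
    1 fun x => by
      rw [one_mul]
      exact le_of_tendsto (hB.cauchySeq_yosidaExp t x).tendsto_limUnder.norm
        (Eventually.of_forall fun n => hB.norm_yosidaExp_le n t x)

lemma tendsto_yosidaExp (hB : IsDissipativeInverse B) (t : ℝ≥0) (x : H) :
    Tendsto (fun n => yosidaExp B n t x) atTop (𝓝 (hB.semigroupOp t x)) :=
  (hB.cauchySeq_yosidaExp t x).tendsto_limUnder

lemma norm_semigroupOp_le_one (hB : IsDissipativeInverse B) (t : ℝ≥0) :
    ‖hB.semigroupOp t‖ ≤ 1 :=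
  LinearMap.mkContinuous_norm_le _ zero_le_one _

lemma norm_semigroupOp_apply_le (hB : IsDissipativeInverse B) (t : ℝ≥0) (x : H) :
    ‖hB.semigroupOp t x‖ ≤ ‖x‖ :=
  (hB.semigroupOp t).le_of_opNorm_le (hB.norm_semigroupOp_le_one t) x |>.trans (one_mul _).le

lemma tendsto_yosidaExp_of_tendsto (hB : IsDissipativeInverse B) (t : ℝ≥0) {x : ℕ → H} {y : H}
    (hx : Tendsto x atTop (𝓝 y)) :
    Tendsto (fun n => yosidaExp B n t (x n)) atTop (𝓝 (hB.semigroupOp t y)) := by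
  have h : Tendsto (fun n => yosidaExp B n t (x n - y)) atTop (𝓝 0) := by
    rw [tendsto_zero_iff_norm_tendsto_zero]
    refine squeeze_zero (fun n => norm_nonneg _) (fun n => hB.norm_yosidaExp_le n t _) ?_
    rw [← tendsto_zero_iff_norm_tendsto_zero]
    exact tendsto_sub_nhds_zero_iff.2 hx
  simpa using h.add (hB.tendsto_yosidaExp t y)

lemma semigroupOp_zero (hB : IsDissipativeInverse B) :
    hB.semigroupOp 0 = ContinuousLinearMap.id ℂ H := by
  ext x
  refine tendsto_nhds_unique (hB.tendsto_yosidaExp 0 x) ?_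
  simp [yosidaExp]

lemma semigroupOp_add (hB : IsDissipativeInverse B) (s t : ℝ≥0) :
    hB.semigroupOp (s + t) = (hB.semigroupOp s).comp (hB.semigroupOp t) := by
  ext x
  refine tendsto_nhds_unique (hB.tendsto_yosidaExp (s + t) x) ?_
  have h := hB.tendsto_yosidaExp_of_tendsto s (hB.tendsto_yosidaExp t x)
  refine h.congr fun n => ?_
  let +nondep : NormedAlgebra ℚ (H →L[ℂ] H) := NormedAlgebra.restrictScalars ℚ ℂ _
  rw [yosidaExp, yosidaExp, yosidaExp, NNReal.coe_add, add_smul, NormedSpace.exp_add_of_commute]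
  · rfl
  · exact ((Commute.refl _).smul_left _).smul_right _

lemma semigroupOp_apply_comm (hB : IsDissipativeInverse B) (t : ℝ≥0) (x : H) :
    hB.semigroupOp t (B x) = B (hB.semigroupOp t x) := by
  refine tendsto_nhds_unique (hB.tendsto_yosidaExp t (B x)) ?_
  simp only [hB.yosidaExp_apply_comm]
  exact (B.continuous.tendsto _).comp (hB.tendsto_yosidaExp t x)

/-- The orbits of the approximating semigroups solve their evolution equations. -/
lemma integral_yosidaExp (hB : IsDissipativeInverse B) (n : ℕ) (t : ℝ≥0) (z : H) :
    ∫ s in (0 : ℝ)..t, yosidaExp B n s.toNNReal z =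
      yosidaExp B n t (B z - ((1 / ((n : ℝ) + 1) : ℝ) : ℂ) • z)
        - (B z - ((1 / ((n : ℝ) + 1) : ℝ) : ℂ) • z) := by
  set A := yosida B (1 / ((n : ℝ) + 1)) with hA
  have hAz : A (B z - ((1 / ((n : ℝ) + 1) : ℝ) : ℂ) • z) = z := by
    rw [map_sub, map_smul, hA, hB.yosida_apply Nat.one_div_pos_of_nat, add_sub_cancel_right]
  have hd := fun s : ℝ =>
    hasDerivAt_exp_smul_apply A (B z - ((1 / ((n : ℝ) + 1) : ℝ) : ℂ) • z) s
  simp only [hAz] at hd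
  have hc : Continuous fun s : ℝ => NormedSpace.exp (s • A) z :=
    continuous_iff_continuousAt.2 fun s => (hasDerivAt_exp_smul_apply A z s).continuousAt
  have h := intervalIntegral.integral_eq_sub_of_hasDerivAt (a := 0) (b := t)
    (fun s _ => hd s) (hc.intervalIntegrable _ _)
  rw [zero_smul, NormedSpace.exp_zero, one_apply_eq_self] at h
  rw [yosidaExp, ← hA, ← h]
  refine intervalIntegral.integral_congr fun s hs => ?_
  have hs0 : 0 ≤ s := (uIcc_of_le (NNReal.coe_nonneg t) ▸ hs).1
  change NormedSpace.exp (((s.toNNReal : ℝ≥0) : ℝ) • A) z = _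
  rw [Real.coe_toNNReal _ hs0]

lemma continuous_yosidaExp (B : H →L[ℂ] H) (n : ℕ) (z : H) :
    Continuous fun s : ℝ≥0 => yosidaExp B n s z :=
  (continuous_iff_continuousAt.2 fun s =>
    (hasDerivAt_exp_smul_apply (yosida B (1 / ((n : ℝ) + 1))) z s).continuousAt).comp
      NNReal.continuous_coe

/-- The integrated form of the evolution equation on the domain of the generator. -/
lemma integral_semigroupOp (hB : IsDissipativeInverse B) (t : ℝ≥0) (z : H) :
    ∫ s in (0 : ℝ)..t, hB.semigroupOp s.toNNReal z = hB.semigroupOp t (B z) - B z := by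
  have h1 : Tendsto (fun n => ∫ s in (0 : ℝ)..t, yosidaExp B n s.toNNReal z) atTop
      (𝓝 (∫ s in (0 : ℝ)..t, hB.semigroupOp s.toNNReal z)) := by
    refine intervalIntegral.tendsto_integral_filter_of_dominated_convergence (fun _ => ‖z‖)
      (Eventually.of_forall fun n => ?_) (Eventually.of_forall fun n => ?_)
      intervalIntegrable_const ?_
    · exact ((continuous_yosidaExp B n z).comp continuous_real_toNNReal).aestronglyMeasurable
    · exact ae_of_all _ fun s _ => hB.norm_yosidaExp_le n _ z
    · exact ae_of_all _ fun s _ => hB.tendsto_yosidaExp _ z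
  refine tendsto_nhds_unique h1 ?_
  simp only [hB.integral_yosidaExp]
  have h2 : Tendsto (fun n : ℕ => B z - ((1 / ((n : ℝ) + 1) : ℝ) : ℂ) • z) atTop (𝓝 (B z)) := by
    have h3 := (Complex.continuous_ofReal.tendsto 0).comp
      (tendsto_one_div_add_atTop_nhds_zero_nat (𝕜 := ℝ))
    simpa using (h3.smul_const z).const_sub (B z)
  exact (hB.tendsto_yosidaExp_of_tendsto t h2).sub h2

lemma semigroupOp_sub_apply_le (hB : IsDissipativeInverse B) (s t : ℝ≥0) (z : H) :
    ‖hB.semigroupOp t (B z) - hB.semigroupOp s (B z)‖ ≤ ‖z‖ * dist t s := by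
  wlog hst : s ≤ t generalizing s t
  · rw [norm_sub_rev, dist_comm]
    exact this t s (le_of_not_ge hst)
  obtain ⟨r, rfl⟩ := exists_add_of_le hst
  rw [hB.semigroupOp_add, ContinuousLinearMap.comp_apply, ← map_sub]
  refine (hB.norm_semigroupOp_apply_le s _).trans ?_
  rw [← hB.integral_semigroupOp]
  refine (intervalIntegral.norm_integral_le_of_norm_le_const
    (fun x _ => hB.norm_semigroupOp_apply_le _ z)).trans (le_of_eq ?_)
  rw [NNReal.dist_eq, NNReal.coe_add, sub_zero, add_sub_cancel_left]

lemma continuous_semigroupOp (hB : IsDissipativeInverse B) (x : H) :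
    Continuous fun t => hB.semigroupOp t x := by
  refine continuous_of_uniform_approx_of_continuous fun U hU => ?_
  obtain ⟨ε, hε, hsub⟩ := Metric.mem_uniformity_dist.1 hU
  obtain ⟨w, hw⟩ := hB.denseRange.exists_dist_lt x hε
  refine ⟨fun t => hB.semigroupOp t (B w), ?_, fun t => ?_⟩
  · exact (LipschitzWith.of_dist_le_mul (K := ‖w‖₊) fun t s => by
      rw [dist_eq_norm]
      exact hB.semigroupOp_sub_apply_le s t w).continuous
  · apply hsub
    rw [dist_eq_norm, ← map_sub]
    refine (hB.norm_semigroupOp_apply_le t _).trans_lt ?_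
    rwa [← dist_eq_norm]

/-- The semigroup generated by `B⁻¹`. -/
def semigroup (hB : IsDissipativeInverse B) : C0Semigroup H where
  S := hB.semigroupOp
  S_zero := hB.semigroupOp_zero
  S_add := hB.semigroupOp_add
  tendsto_zero x := by
    have h := (hB.continuous_semigroupOp x).tendsto 0
    rw [hB.semigroupOp_zero] at h
    exact h.mono_left nhdsWithin_le_nhds

/-- An extension to the real line of the orbit of `B z`, differentiable everywhere. -/
lemma hasDerivAt_add_integral (hB : IsDissipativeInverse B) (z : H) (t : ℝ) :
    HasDerivAt (fun t => B z + ∫ s in (0 : ℝ)..t, hB.semigroupOp s.toNNReal z)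
      (hB.semigroupOp t.toNNReal z) t := by
  have hc : Continuous fun s : ℝ => hB.semigroupOp s.toNNReal z :=
    (hB.continuous_semigroupOp z).comp continuous_real_toNNReal
  exact (hc.integral_hasStrictDerivAt 0 t).hasDerivAt.const_add (B z)

lemma add_integral_eq (hB : IsDissipativeInverse B) (z : H) (t : ℝ≥0) :
    B z + ∫ s in (0 : ℝ)..t, hB.semigroupOp s.toNNReal z = hB.semigroupOp t (B z) := by
  rw [hB.integral_semigroupOp, add_sub_cancel]

lemma tendsto_inv_smul_semigroupOp_sub (hB : IsDissipativeInverse B) (z : H) :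
    Tendsto (fun t : ℝ≥0 => ((t : ℝ) : ℂ)⁻¹ • (hB.semigroupOp t (B z) - B z)) (𝓝[>] 0)
      (𝓝 z) := by
  have h := hasDerivAt_iff_tendsto_slope_zero.1 (hB.hasDerivAt_add_integral z 0)
  rw [Real.toNNReal_zero, hB.semigroupOp_zero, ContinuousLinearMap.id_apply] at h
  have hc : Tendsto (fun t : ℝ≥0 => (t : ℝ)) (𝓝[>] 0) (𝓝[≠] 0) := by
    refine tendsto_nhdsWithin_iff.2 ⟨?_, ?_⟩
    · exact (NNReal.continuous_coe.tendsto 0).mono_left nhdsWithin_le_nhds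
    · filter_upwards [self_mem_nhdsWithin] with t ht
      exact NNReal.coe_ne_zero.2 (ne_of_gt ht)
  refine (h.comp hc).congr fun t => ?_
  simp only [Function.comp_apply, zero_add, hB.add_integral_eq]
  rw [← Complex.ofReal_inv, Complex.coe_smul, intervalIntegral.integral_same, add_zero]

/-- The generator of the semigroup is the inverse of `B`. That its domain is not larger than the
range of `B` is seen by applying `B`, which commutes with the semigroup, to the difference
quotients. -/
lemma tendsto_inv_smul_semigroupOp_sub_iff (hB : IsDissipativeInverse B) (x z : H) :
    Tendsto (fun t : ℝ≥0 => ((t : ℝ) : ℂ)⁻¹ • (hB.semigroupOp t x - x)) (𝓝[>] 0) (𝓝 z) ↔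
      x = B z := by
  refine ⟨fun h => ?_, fun h => h ▸ hB.tendsto_inv_smul_semigroupOp_sub z⟩
  refine tendsto_nhds_unique (hB.tendsto_inv_smul_semigroupOp_sub x) ?_
  refine ((B.continuous.tendsto z).comp h).congr fun t => ?_
  rw [Function.comp_apply, map_smul, map_sub, hB.semigroupOp_apply_comm]

/-! ### Strong stability of contraction semigroups with compact inverse generator -/

/-- The subspace on which the semigroup is isometric, that is, of the `z` with `S(t)† S(t) z = z`
for all `t`. In this form it is plainly a closed linear subspace. -/
def isometricSubspace (hB : IsDissipativeInverse B) : Submodule ℂ H where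
  carrier := {z | ∀ t w, inner ℂ (hB.semigroupOp t w) (hB.semigroupOp t z) = inner ℂ w z}
  zero_mem' t w := by simp
  add_mem' hx hy t w := by simp only [map_add, inner_add_right, hx t w, hy t w]
  smul_mem' c x hx t w := by simp only [map_smul, inner_smul_right, hx t w]

lemma isClosed_isometricSubspace (hB : IsDissipativeInverse B) :
    IsClosed (hB.isometricSubspace : Set H) := by
  have e : (hB.isometricSubspace : Set H) = ⋂ (t : ℝ≥0) (w : H),
      {z | inner ℂ (hB.semigroupOp t w) (hB.semigroupOp t z) = inner ℂ w z} := by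
    ext z
    simp [isometricSubspace]
  rw [e]
  exact isClosed_iInter fun t => isClosed_iInter fun w => isClosed_eq (by fun_prop) (by fun_prop)

lemma mem_isometricSubspace_of_norm_eq (hB : IsDissipativeInverse B) {z : H}
    (h : ∀ t, ‖hB.semigroupOp t z‖ = ‖z‖) : z ∈ hB.isometricSubspace := by
  intro t w
  set T := hB.semigroupOp t with hT
  -- `‖T† T z - z‖² ≤ ‖T z‖² - 2 ‖T z‖² + ‖z‖² = 0`
  have h1 : T.adjoint (T z) = z := by
    have h2 : ‖T.adjoint (T z)‖ ≤ ‖z‖ := by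
      refine (T.adjoint.le_of_opNorm_le ?_ _).trans ((one_mul _).trans (h t)).le
      rw [LinearIsometryEquiv.norm_map]
      exact hB.norm_semigroupOp_le_one t
    have h3 := norm_sub_sq (𝕜 := ℂ) (T.adjoint (T z)) z
    rw [ContinuousLinearMap.adjoint_inner_left, inner_self_eq_norm_sq, h t] at h3
    have h4 : ‖T.adjoint (T z)‖ ^ 2 ≤ ‖z‖ ^ 2 := by gcongr
    have h5 : ‖T.adjoint (T z) - z‖ ^ 2 = 0 := le_antisymm (by linarith) (sq_nonneg _)
    exact sub_eq_zero.1 (norm_eq_zero.1 (pow_eq_zero_iff two_ne_zero |>.1 h5))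
  rw [← ContinuousLinearMap.adjoint_inner_right, h1]

/-- On the subspace where the semigroup is isometric, `‖S(t) B z‖²` is an affine function of `t`
with slope `2 Re ⟪z, B z⟫`; being bounded, it is constant. -/
lemma norm_semigroupOp_apply_of_mem (hB : IsDissipativeInverse B) {z : H}
    (hz : z ∈ hB.isometricSubspace) (t : ℝ≥0) :
    ‖hB.semigroupOp t (B z)‖ ^ 2 = ‖B z‖ ^ 2 + t * (2 * (inner ℂ z (B z)).re) := by
  set c := 2 * (inner ℂ z (B z)).re with hc
  set u : ℝ → H := fun t => B z + ∫ s in (0 : ℝ)..t, hB.semigroupOp s.toNNReal z with hu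
  have hd : ∀ s : ℝ, 0 ≤ s → HasDerivAt (fun s => ‖u s‖ ^ 2 - s * c) 0 s := by
    intro s hs
    have h1 := hasDerivAt_norm_sq (hB.hasDerivAt_add_integral z s)
    lift s to ℝ≥0 using hs
    rw [hB.add_integral_eq, Real.toNNReal_coe, hz s (B z), ← inner_conj_symm, Complex.conj_re] at h1
    have h2 := h1.sub ((hasDerivAt_id (s : ℝ)).mul_const c)
    refine h2.congr_deriv ?_
    rw [one_mul, sub_self]
  have h := constant_of_has_deriv_right_zero (f := fun s => ‖u s‖ ^ 2 - s * c) (a := 0) (b := t)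
    (fun s hs => (hd s hs.1).continuousAt.continuousWithinAt)
    (fun s hs => (hd s hs.1).hasDerivWithinAt) t (right_mem_Icc.2 t.2)
  simp only [hu, hB.add_integral_eq, intervalIntegral.integral_same, add_zero, zero_mul,
    sub_zero] at h
  linarith

lemma re_inner_eq_zero_of_mem (hB : IsDissipativeInverse B) {z : H}
    (hz : z ∈ hB.isometricSubspace) : (inner ℂ z (B z)).re = 0 := by
  refine le_antisymm (hB.re_inner_nonpos z) (not_lt.1 fun hlt => ?_)
  have hpos : 0 < -(2 * (inner ℂ z (B z)).re) := by linarith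
  -- at this time the affine function would take the value `-1`
  obtain ⟨t, ht⟩ : ∃ t : ℝ≥0, (t : ℝ) = (‖B z‖ ^ 2 + 1) / -(2 * (inner ℂ z (B z)).re) :=
    ⟨⟨_, by positivity⟩, rfl⟩
  have h := hB.norm_semigroupOp_apply_of_mem hz t
  have e : (‖B z‖ ^ 2 + 1) / -(2 * (inner ℂ z (B z)).re) * (2 * (inner ℂ z (B z)).re)
      = -(‖B z‖ ^ 2 + 1) := by
    rw [div_neg, neg_mul, div_mul_cancel₀ _ (by linarith)]
  rw [ht, e] at h
  have := sq_nonneg ‖hB.semigroupOp t (B z)‖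
  linarith

lemma apply_mem_isometricSubspace (hB : IsDissipativeInverse B) {z : H}
    (hz : z ∈ hB.isometricSubspace) : B z ∈ hB.isometricSubspace := by
  refine hB.mem_isometricSubspace_of_norm_eq fun t => ?_
  have h := hB.norm_semigroupOp_apply_of_mem hz t
  rw [hB.re_inner_eq_zero_of_mem hz, mul_zero, mul_zero, add_zero] at h
  exact (sq_eq_sq₀ (norm_nonneg _) (norm_nonneg _)).1 h

/-- The part of `i B` in the subspace where the semigroup is isometric is symmetric and compact, so
it is zero if it has no nonzero eigenvalue. -/
lemma isometricSubspace_eq_bot (hB : IsDissipativeInverse B) (hc : IsCompactOperator B)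
    (heig : ∀ (r : ℝ) (z : H), r ≠ 0 → B z = (r * Complex.I) • z → z = 0) :
    hB.isometricSubspace = ⊥ := by
  set M := hB.isometricSubspace with hM
  have hMc : IsClosed (M : Set H) := hB.isClosed_isometricSubspace
  have : CompleteSpace M := hMc.completeSpace_coe
  set T : M →L[ℂ] M := Complex.I • B.restrict (fun z hz => hB.apply_mem_isometricSubspace hz)
    with hT
  have hTapp : ∀ z : M, ((T z : M) : H) = Complex.I • B z := fun z => rfl
  have hTc : IsCompactOperator T := by
    have h := IsCompactOperator.restrict (f := (B : H →ₗ[ℂ] H)) hc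
      (fun z hz => hB.apply_mem_isometricSubspace hz) hMc
    exact h.smul Complex.I
  have hTs : (T : M →ₗ[ℂ] M).IsSymmetric := by
    rw [LinearMap.isSymmetric_iff_inner_map_self_real]
    intro z
    have h0 := hB.re_inner_eq_zero_of_mem z.2
    rw [← inner_conj_symm, Complex.conj_re] at h0
    rw [Complex.conj_eq_iff_im]
    change (inner ℂ ((T z : M) : H) (z : H) : ℂ).im = 0
    rw [hTapp, inner_smul_left, Complex.mul_im, h0]
    simp
  have hT0 : T = 0 := by
    refine (ContinuousLinearMap.eq_zero_of_forall_hasEigenvalue_eq_zero hTc hTs).1 fun μ hμ => ?_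
    by_contra hne
    obtain ⟨z, hz⟩ := hμ.exists_hasEigenvector
    have hreal : conj μ = μ := hTs.conj_eigenvalue_eq_self hμ
    obtain ⟨r, rfl⟩ := Complex.conj_eq_iff_real.1 hreal
    have h1 : Complex.I • B z = (r : ℂ) • (z : H) := by
      have := congrArg (Subtype.val) hz.apply_eq_smul
      exact this
    refine hz.2 (Subtype.ext (heig (-r) z (by simpa using hne) ?_))
    have h2 := congrArg (fun y => (-Complex.I) • y) h1
    simp only [smul_smul, neg_mul, Complex.I_mul_I, neg_neg, one_smul] at h2
    rw [h2]
    congr 1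
    push_cast
    ring
  rw [Submodule.eq_bot_iff]
  intro z hz
  have h1 : Complex.I • B z = 0 := by
    have := congrArg Subtype.val (DFunLike.congr_fun hT0 (⟨z, hz⟩ : M))
    exact this
  have h2 : B z = 0 := (smul_eq_zero.1 h1).resolve_left Complex.I_ne_zero
  exact hB.injective (by rw [h2, map_zero])

lemma antitone_norm_semigroupOp (hB : IsDissipativeInverse B) (x : H) :
    Antitone fun t => ‖hB.semigroupOp t x‖ := by
  intro s t hst
  obtain ⟨r, rfl⟩ := exists_add_of_le hst
  simp only
  rw [add_comm, hB.semigroupOp_add]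
  exact hB.norm_semigroupOp_apply_le r _

/-- A contraction semigroup whose generator has a compact inverse and no imaginary eigenvalue is
strongly stable: the limit points of an orbit in the domain of the generator lie in the subspace
on which the semigroup is isometric, which is trivial. -/
lemma tendsto_norm_semigroupOp (hB : IsDissipativeInverse B) (hc : IsCompactOperator B)
    (heig : ∀ (r : ℝ) (z : H), r ≠ 0 → B z = (r * Complex.I) • z → z = 0) (x : H) :
    Tendsto (fun t => ‖hB.semigroupOp t x‖) atTop (𝓝 0) := by
  have hdom : ∀ w, Tendsto (fun t => ‖hB.semigroupOp t (B w)‖) atTop (𝓝 0) := by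
    intro w
    obtain ⟨c, hlim⟩ : ∃ c, Tendsto (fun t => ‖hB.semigroupOp t (B w)‖) atTop (𝓝 c) :=
      ⟨_, tendsto_atTop_ciInf (hB.antitone_norm_semigroupOp (B w))
        ⟨0, by rintro _ ⟨t, rfl⟩; exact norm_nonneg _⟩⟩
    obtain ⟨K, hK, hsub⟩ := IsCompactOperator.image_closedBall_subset_compact
      (f := (B : H →ₗ[ℂ] H)) hc ‖w‖
    have hmem : ∀ n : ℕ, hB.semigroupOp n (B w) ∈ K := fun n => by
      rw [hB.semigroupOp_apply_comm]
      exact hsub ⟨_, mem_closedBall_zero_iff.2 (hB.norm_semigroupOp_apply_le _ w), rfl⟩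
    obtain ⟨z, -, φ, hφ, hz⟩ := hK.tendsto_subseq hmem
    have hcast : Tendsto (fun k => ((φ k : ℕ) : ℝ≥0)) atTop atTop :=
      tendsto_natCast_atTop_atTop.comp hφ.tendsto_atTop
    have hnorm : ∀ t, ‖hB.semigroupOp t z‖ = c := by
      intro t
      have h1 := (((hB.semigroupOp t).continuous.tendsto z).comp hz).norm
      have hshift : Tendsto (fun k => t + ((φ k : ℕ) : ℝ≥0)) atTop atTop :=
        tendsto_atTop_mono (fun k => le_add_self) hcast
      have h2 := hlim.comp hshift
      refine tendsto_nhds_unique h1 (h2.congr fun k => ?_)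
      simp only [Function.comp_apply, hB.semigroupOp_add, ContinuousLinearMap.comp_apply]
    have hz0 : ‖z‖ = c := by
      have := hnorm 0
      rwa [hB.semigroupOp_zero] at this
    have hzM := hB.mem_isometricSubspace_of_norm_eq fun t => (hnorm t).trans hz0.symm
    rw [hB.isometricSubspace_eq_bot hc heig, Submodule.mem_bot] at hzM
    rwa [← hz0, hzM, norm_zero] at hlim
  rw [Metric.tendsto_nhds]
  intro ε hε
  obtain ⟨w, hw⟩ := hB.denseRange.exists_dist_lt x (half_pos hε)
  filter_upwards [(hdom w).eventually (gt_mem_nhds (half_pos hε))] with t ht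
  rw [dist_zero_right, norm_norm]
  have h1 := norm_add_le (hB.semigroupOp t (x - B w)) (hB.semigroupOp t (B w))
  rw [← map_add, sub_add_cancel] at h1
  have h2 := hB.norm_semigroupOp_apply_le t (x - B w)
  rw [dist_eq_norm] at hw
  linarith

end IsDissipativeInverse

end Generation

section Primitive

variable {ℓ : ℝ}

/-! ### The primitive operator on `L²(0, ℓ)` -/

/-- The constant function `1` as an element of `L²(0, ℓ)`. -/
def one (ℓ : ℝ) : L2 ℓ := Lp.const 2 _ (1 : ℂ)

/-- The functional `f ↦ ∫₀^ℓ f`, written as the inner product with the constant `1`. -/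
def tot (ℓ : ℝ) : L2 ℓ →L[ℂ] ℂ := innerSL ℂ (one ℓ)

/-- The indicator function of `(0, x)` as an element of `L²(0, ℓ)`. -/
def cutoff (ℓ x : ℝ) : L2 ℓ :=
  indicatorConstLp 2 (measurableSet_Iio (a := x)) (measure_ne_top _ _) (1 : ℂ)

/-- The continuous primitive `x ↦ ∫₀ˣ f` of `f ∈ L²(0, ℓ)`, extended by constants outside of
`[0, ℓ]`. It is an inner product with a cutoff function, which makes its linearity, continuity
and boundedness immediate. -/
def prim (f : L2 ℓ) (x : ℝ) : ℂ := inner ℂ (cutoff ℓ x) f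

lemma coeFn_one : one ℓ =ᵐ[volume.restrict (Ioo (0 : ℝ) ℓ)] fun _ => (1 : ℂ) :=
  Lp.coeFn_const _ _ _

lemma tot_apply (f : L2 ℓ) : tot ℓ f = inner ℂ (one ℓ) f := rfl

lemma inner_one_right (f : L2 ℓ) : inner ℂ f (one ℓ) = conj (tot ℓ f) :=
  (inner_conj_symm _ _).symm

lemma tot_eq_integral (f : L2 ℓ) : tot ℓ f = ∫ x in Ioo (0 : ℝ) ℓ, f x := by
  rw [tot_apply, L2.inner_def]
  refine integral_congr_ae ?_
  filter_upwards [coeFn_one (ℓ := ℓ)] with x hx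
  rw [hx]
  simp

lemma tot_one (hℓ : 0 < ℓ) : tot ℓ (one ℓ) = ℓ := by
  rw [tot_eq_integral, integral_congr_ae coeFn_one]
  simp [hℓ.le]

lemma prim_eq_setIntegral (f : L2 ℓ) (x : ℝ) :
    prim f x = ∫ t in Iio x, f t ∂(volume.restrict (Ioo (0 : ℝ) ℓ)) :=
  L2.inner_indicatorConstLp_one _ _ _

lemma prim_eq_intervalIntegral {f : L2 ℓ} {F : ℝ → ℂ}
    (hF : f =ᵐ[volume.restrict (Ioo (0 : ℝ) ℓ)] F) {x : ℝ} (hx : x ∈ Icc 0 ℓ) :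
    prim f x = ∫ t in (0 : ℝ)..x, F t := by
  have e : Iio x ∩ Ioo 0 ℓ = Ioo 0 x := by
    ext t
    simp only [mem_inter_iff, mem_Iio, mem_Ioo]
    exact ⟨fun h => ⟨h.2.1, h.1⟩, fun h => ⟨h.2, h.1, h.2.trans_le hx.2⟩⟩
  rw [prim_eq_setIntegral, integral_congr_ae (ae_restrict_of_ae hF),
    Measure.restrict_restrict measurableSet_Iio, e, intervalIntegral.integral_of_le hx.1,
    integral_Ioc_eq_integral_Ioo]

lemma prim_zero (f : L2 ℓ) : prim f 0 = 0 := by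
  have e : Iio 0 ∩ Ioo 0 ℓ = ∅ := by
    ext t
    simp only [mem_inter_iff, mem_Iio, mem_Ioo, mem_empty_iff_false, iff_false]
    intro h
    linarith [h.1, h.2.1]
  rw [prim_eq_setIntegral, Measure.restrict_restrict measurableSet_Iio, e, setIntegral_empty]

lemma prim_right (f : L2 ℓ) : prim f ℓ = tot ℓ f := by
  have e : Iio ℓ ∩ Ioo 0 ℓ = Ioo 0 ℓ := inter_eq_right.2 fun t h => h.2
  rw [prim_eq_setIntegral, Measure.restrict_restrict measurableSet_Iio, e, tot_eq_integral]

lemma continuous_cutoff : Continuous (cutoff ℓ) := by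
  refine continuous_indicatorConstLp_set (by simp) fun x => ?_
  have hb : ∀ y, volume.restrict (Ioo (0 : ℝ) ℓ) (symmDiff (Iio y) (Iio x))
      ≤ ENNReal.ofReal (max y x - min y x) := by
    intro y
    refine (Measure.restrict_apply_le _ _).trans ?_
    rw [← Real.volume_Icc]
    refine measure_mono ?_
    rintro t (⟨h1, h2⟩ | ⟨h1, h2⟩)
    · exact ⟨(min_le_right _ _).trans (not_lt.1 h2), le_max_of_le_left (le_of_lt h1)⟩
    · exact ⟨(min_le_left _ _).trans (not_lt.1 h2), le_max_of_le_right (le_of_lt h1)⟩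
  refine tendsto_of_tendsto_of_tendsto_of_le_of_le tendsto_const_nhds ?_ (fun _ => zero_le) hb
  have hc : Continuous fun y => ENNReal.ofReal (max y x - min y x) :=
    ENNReal.continuous_ofReal.comp (by fun_prop)
  simpa using hc.tendsto x

lemma norm_cutoff_le (x : ℝ) : ‖cutoff ℓ x‖ ≤ ‖one ℓ‖ := by
  refine Lp.norm_le_norm_of_ae_le ?_
  filter_upwards [coeFn_one (ℓ := ℓ), indicatorConstLp_coeFn (p := 2)
    (μ := volume.restrict (Ioo (0 : ℝ) ℓ)) (hs := measurableSet_Iio (a := x))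
    (hμs := measure_ne_top _ _) (c := (1 : ℂ))] with t h1 h2
  rw [h1, cutoff, h2]
  exact norm_indicator_le_norm_self _ _

lemma continuous_prim (f : L2 ℓ) : Continuous (prim f) :=
  continuous_cutoff.inner continuous_const

lemma norm_prim_le (f : L2 ℓ) (x : ℝ) : ‖prim f x‖ ≤ ‖one ℓ‖ * ‖f‖ :=
  (norm_inner_le_norm _ _).trans (by gcongr; exact norm_cutoff_le x)

/-- The primitive of `f`, as a bounded continuous function. -/
def primBCF (f : L2 ℓ) : BoundedContinuousFunction ℝ ℂ :=
  BoundedContinuousFunction.ofNormedAddCommGroup (prim f) (continuous_prim f) _ (norm_prim_le f)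

/-- The primitive operator `(J f)(x) = ∫₀ˣ f` on `L²(0, ℓ)`. -/
def J (ℓ : ℝ) : L2 ℓ →L[ℂ] L2 ℓ :=
  LinearMap.mkContinuous
    { toFun := fun f => BoundedContinuousFunction.toLp 2 (volume.restrict (Ioo 0 ℓ)) ℂ (primBCF f)
      map_add' := fun f g => by
        rw [← map_add]
        congr 1
        ext x
        exact inner_add_right (cutoff ℓ x) f g
      map_smul' := fun c f => by
        rw [← map_smul]
        congr 1
        ext x
        exact inner_smul_right (cutoff ℓ x) f c }
    (‖BoundedContinuousFunction.toLp (E := ℂ) 2 (volume.restrict (Ioo 0 ℓ)) ℂ‖ * ‖one ℓ‖)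
    fun f => by
      rw [mul_assoc]
      refine ((BoundedContinuousFunction.toLp (E := ℂ) 2
        (volume.restrict (Ioo 0 ℓ)) ℂ).le_opNorm _).trans ?_
      gcongr
      exact BoundedContinuousFunction.norm_ofNormedAddCommGroup_le _ (by positivity) _

lemma coeFn_J (f : L2 ℓ) : J ℓ f =ᵐ[volume.restrict (Ioo (0 : ℝ) ℓ)] prim f :=
  BoundedContinuousFunction.coeFn_toLp _ _ _ _

lemma hasValueAt_J (f : L2 ℓ) (a : ℝ) : HasValueAt (J ℓ f) a (prim f a) :=
  ⟨prim f, (continuous_prim f).continuousOn, coeFn_J f, rfl⟩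

lemma hasValueAt_J_zero (f : L2 ℓ) : HasValueAt (J ℓ f) 0 0 := by
  simpa [prim_zero] using hasValueAt_J f 0

lemma hasValueAt_J_right (f : L2 ℓ) : HasValueAt (J ℓ f) ℓ (tot ℓ f) := by
  simpa [prim_right] using hasValueAt_J f ℓ

lemma hasValueAt_one (a : ℝ) : HasValueAt (one ℓ) a 1 :=
  ⟨fun _ => 1, continuousOn_const, coeFn_one, rfl⟩

lemma HasValueAt.unique (hℓ : 0 < ℓ) {f : L2 ℓ} {a : ℝ} (ha : a ∈ Icc 0 ℓ) {c d : ℂ}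
    (hc : HasValueAt f a c) (hd : HasValueAt f a d) : c = d := by
  obtain ⟨F, hF, hfF, rfl⟩ := hc
  obtain ⟨G, hG, hfG, rfl⟩ := hd
  have hE : F =ᵐ[volume.restrict (Icc (0 : ℝ) ℓ)] G := by
    rw [← restrict_Ioo_eq_restrict_Icc]
    exact hfF.symm.trans hfG
  exact Measure.eqOn_Icc_of_ae_eq volume hℓ.ne hE hF hG ha

/-! ### Integration by parts -/

/-- Fubini's theorem on the triangle `t < x`. -/
lemma integral_mul_integral_Iio {μ : Measure ℝ} [SFinite μ] {f g : ℝ → ℂ} (hf : Integrable f μ)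
    (hg : Integrable g μ) :
    ∫ x, f x * ∫ t in Iio x, g t ∂μ ∂μ = ∫ t, (∫ x in Ioi t, f x ∂μ) * g t ∂μ := by
  have hm : MeasurableSet {p : ℝ × ℝ | p.2 < p.1} := measurableSet_lt measurable_snd measurable_fst
  have hint : Integrable (fun p : ℝ × ℝ => {p : ℝ × ℝ | p.2 < p.1}.indicator
      (fun p => f p.1 * g p.2) p) (μ.prod μ) := (hf.mul_prod hg).indicator hm
  have h := integral_integral_swap
    (f := fun x t => {p : ℝ × ℝ | p.2 < p.1}.indicator (fun p => f p.1 * g p.2) (x, t)) hint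
  have e1 : ∀ x, ∫ t, {p : ℝ × ℝ | p.2 < p.1}.indicator (fun p => f p.1 * g p.2) (x, t) ∂μ
      = f x * ∫ t in Iio x, g t ∂μ := by
    intro x
    rw [← integral_indicator measurableSet_Iio, ← integral_const_mul]
    refine integral_congr_ae (ae_of_all _ fun t => ?_)
    by_cases ht : t < x <;> simp [indicator, ht]
  have e2 : ∀ t, ∫ x, {p : ℝ × ℝ | p.2 < p.1}.indicator (fun p => f p.1 * g p.2) (x, t) ∂μ
      = (∫ x in Ioi t, f x ∂μ) * g t := by
    intro t
    rw [← integral_indicator measurableSet_Ioi, ← integral_mul_const]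
    refine integral_congr_ae (ae_of_all _ fun x => ?_)
    by_cases ht : t < x <;> simp [indicator, ht]
  simpa only [e1, e2] using h

/-- Up to a rank one operator, the primitive operator is skew-adjoint. -/
lemma inner_J_add_inner_J (f g : L2 ℓ) :
    inner ℂ (J ℓ f) g + inner ℂ f (J ℓ g) = conj (tot ℓ f) * tot ℓ g := by
  set μ := volume.restrict (Ioo (0 : ℝ) ℓ) with hμ
  have hfc : Integrable (fun x => conj (f x)) μ :=
    (Complex.conjCLE.toContinuousLinearMap.integrable_comp f.integrable)
  have e1 : inner ℂ (J ℓ f) g = ∫ x, (∫ t in Iio x, conj (f t) ∂μ) * g x ∂μ := by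
    rw [L2.inner_def]
    refine integral_congr_ae ?_
    filter_upwards [coeFn_J f] with x hx
    rw [hx, prim_eq_setIntegral, RCLike.inner_apply, mul_comm, ← integral_conj]
  have e2 : inner ℂ f (J ℓ g) = ∫ x, (∫ t in Ioi x, conj (f t) ∂μ) * g x ∂μ := by
    rw [L2.inner_def, ← integral_mul_integral_Iio hfc g.integrable]
    refine integral_congr_ae ?_
    filter_upwards [coeFn_J g] with x hx
    rw [hx, prim_eq_setIntegral, RCLike.inner_apply, mul_comm]
  have i1 : Integrable (fun x => (∫ t in Iio x, conj (f t) ∂μ) * g x) μ := by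
    refine (L2.integrable_inner (𝕜 := ℂ) (J ℓ f) g).congr ?_
    filter_upwards [coeFn_J f] with x hx
    rw [hx, prim_eq_setIntegral, RCLike.inner_apply, mul_comm, ← integral_conj]
  have hsplit : ∀ x, (∫ t in Iio x, conj (f t) ∂μ) + (∫ t in Ioi x, conj (f t) ∂μ)
      = conj (tot ℓ f) := by
    intro x
    have h := integral_add_compl (μ := μ) (measurableSet_Iio (a := x)) hfc
    rw [compl_Iio, integral_Ici_eq_integral_Ioi] at h
    rw [h, tot_eq_integral, integral_conj]
  have i2 : Integrable (fun x => (∫ t in Ioi x, conj (f t) ∂μ) * g x) μ := by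
    refine ((g.integrable.const_mul (conj (tot ℓ f))).sub i1).congr (ae_of_all _ fun x => ?_)
    simp only [Pi.sub_apply, ← hsplit x]
    ring
  rw [e1, e2, ← integral_add i1 i2]
  simp only [← add_mul, hsplit]
  rw [integral_const_mul, ← tot_eq_integral]

lemma IsTest.integral_deriv {φ : ℝ → ℝ} (hφ : IsTest ℓ φ) {t : ℝ} (ht : t ≤ ℓ) :
    ∫ x in Ioo t ℓ, deriv φ x = -φ t := by
  have hℓ : φ ℓ = 0 := image_eq_zero_of_notMem_tsupport fun h => lt_irrefl _ (hφ.subset h).2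
  rw [← integral_Ioc_eq_integral_Ioo, ← intervalIntegral.integral_of_le ht,
    intervalIntegral.integral_deriv_eq_sub (fun x _ => (hφ.smooth.differentiable (by simp)) x)
      (hφ.continuous_deriv.intervalIntegrable _ _), hℓ, zero_sub]

lemma isWeakDeriv_J (f : L2 ℓ) : IsWeakDeriv (J ℓ f) f := by
  intro φ hφ
  have hi : Integrable (fun x => ((deriv φ x : ℝ) : ℂ)) (volume.restrict (Ioo (0 : ℝ) ℓ)) :=
    ((hφ.continuous_deriv.integrable_of_hasCompactSupport hφ.compact.deriv).restrict).ofReal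
  have h := integral_mul_integral_Iio hi f.integrable
  have e1 : ∫ x in Ioo (0 : ℝ) ℓ, deriv φ x • J ℓ f x
      = ∫ x in Ioo (0 : ℝ) ℓ, ((deriv φ x : ℝ) : ℂ) *
        ∫ t in Iio x, f t ∂(volume.restrict (Ioo (0 : ℝ) ℓ)) := by
    refine integral_congr_ae ?_
    filter_upwards [coeFn_J f] with x hx
    rw [hx, prim_eq_setIntegral, Complex.real_smul]
  rw [e1, h, ← integral_neg]
  refine setIntegral_congr_fun measurableSet_Ioo fun t ht => ?_
  have e : Ioi t ∩ Ioo 0 ℓ = Ioo t ℓ := by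
    ext x
    simp only [mem_inter_iff, mem_Ioi, mem_Ioo]
    exact ⟨fun h => ⟨h.1, h.2.2⟩, fun h => ⟨h.1, ht.1.trans h.1, h.2⟩⟩
  rw [Measure.restrict_restrict measurableSet_Ioi, e, integral_complex_ofReal,
    hφ.integral_deriv ht.2.le, Complex.real_smul, Complex.ofReal_neg, neg_mul]

lemma isWeakDeriv_one (hℓ : 0 < ℓ) : IsWeakDeriv (one ℓ) 0 := by
  intro φ hφ
  have h0 : φ 0 = 0 := image_eq_zero_of_notMem_tsupport fun h => lt_irrefl _ (hφ.subset h).1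
  have e1 : ∫ x in Ioo (0 : ℝ) ℓ, deriv φ x • one ℓ x
      = ∫ x in Ioo (0 : ℝ) ℓ, ((deriv φ x : ℝ) : ℂ) := by
    refine integral_congr_ae ?_
    filter_upwards [coeFn_one (ℓ := ℓ)] with x hx
    rw [hx, Complex.real_smul, mul_one]
  have e2 : ∫ x in Ioo (0 : ℝ) ℓ, φ x • (0 : L2 ℓ) x = 0 := by
    refine integral_eq_zero_of_ae ?_
    filter_upwards [Lp.coeFn_zero ℂ 2 (volume.restrict (Ioo (0 : ℝ) ℓ))] with x hx
    rw [hx]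
    exact smul_zero _
  rw [e1, e2, integral_complex_ofReal, hφ.integral_deriv hℓ.le, h0]
  simp

/-- A function of `H¹(0, ℓ)` is the sum of its value at `0` and the primitive of its derivative. -/
lemma IsWeakDeriv.exists_eq (hℓ : 0 < ℓ) {f g : L2 ℓ} (h : IsWeakDeriv f g) :
    ∃ c : ℂ, f = c • one ℓ + J ℓ g := by
  have h0 : IsWeakDeriv (f + (-1 : ℂ) • J ℓ g) 0 := by
    have h1 := h.add ((isWeakDeriv_J g).smul (-1))
    rwa [neg_one_smul ℂ g, add_neg_cancel] at h1
  obtain ⟨c, hc⟩ := h0.const_of_zero hℓ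
  refine ⟨c, ?_⟩
  have e : f + (-1 : ℂ) • J ℓ g = c • one ℓ := by
    refine Lp.ext ?_
    filter_upwards [hc, coeFn_one (ℓ := ℓ), Lp.coeFn_smul c (one ℓ)] with x h1 h2 h3
    rw [h1, h3, Pi.smul_apply, h2, smul_eq_mul, mul_one]
  rw [← e]
  module

lemma isWeakDeriv_smul_one_add_J (hℓ : 0 < ℓ) (c : ℂ) (g : L2 ℓ) :
    IsWeakDeriv (c • one ℓ + J ℓ g) g := by
  have h := ((isWeakDeriv_one hℓ).smul c).add (isWeakDeriv_J g)
  rwa [smul_zero, zero_add] at h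

lemma hasValueAt_smul_one_add_J_zero (c : ℂ) (g : L2 ℓ) :
    HasValueAt (c • one ℓ + J ℓ g) 0 c := by
  simpa using ((hasValueAt_one 0).smul c).add (hasValueAt_J_zero g)

lemma hasValueAt_smul_one_add_J_right (c : ℂ) (g : L2 ℓ) :
    HasValueAt (c • one ℓ + J ℓ g) ℓ (c + tot ℓ g) := by
  simpa using ((hasValueAt_one ℓ).smul c).add (hasValueAt_J_right g)

lemma IsWeakDeriv.eq_of_hasValueAt_zero (hℓ : 0 < ℓ) {f g : L2 ℓ} (h : IsWeakDeriv f g) {a : ℂ}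
    (ha : HasValueAt f 0 a) : f = a • one ℓ + J ℓ g := by
  obtain ⟨c, rfl⟩ := h.exists_eq hℓ
  rw [ha.unique hℓ (left_mem_Icc.2 hℓ.le) (hasValueAt_smul_one_add_J_zero c g)]

lemma IsWeakDeriv.exists_hasValueAt (hℓ : 0 < ℓ) {f g : L2 ℓ} (h : IsWeakDeriv f g) :
    ∃ a, HasValueAt f 0 a ∧ HasValueAt f ℓ (a + tot ℓ g) := by
  obtain ⟨c, rfl⟩ := h.exists_eq hℓ
  exact ⟨c, hasValueAt_smul_one_add_J_zero c g, hasValueAt_smul_one_add_J_right c g⟩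

lemma IsWeakDeriv.eq_add_tot (hℓ : 0 < ℓ) {f g : L2 ℓ} (h : IsWeakDeriv f g) {a b : ℂ}
    (ha : HasValueAt f 0 a) (hb : HasValueAt f ℓ b) : b = a + tot ℓ g := by
  obtain ⟨c, hc, hc'⟩ := h.exists_hasValueAt hℓ
  rw [hb.unique hℓ (right_mem_Icc.2 hℓ.le) hc', ha.unique hℓ (left_mem_Icc.2 hℓ.le) hc]

/-- Integration by parts in `H¹(0, ℓ)`. -/
lemma IsWeakDeriv.inner_add_inner (hℓ : 0 < ℓ) {f f' g g' : L2 ℓ} (hf : IsWeakDeriv f f')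
    (hg : IsWeakDeriv g g') {a b c d : ℂ} (hf0 : HasValueAt f 0 a) (hf1 : HasValueAt f ℓ b)
    (hg0 : HasValueAt g 0 c) (hg1 : HasValueAt g ℓ d) :
    inner ℂ f' g + inner ℂ f g' = conj b * d - conj a * c := by
  have h := inner_J_add_inner_J f' g'
  rw [hf.eq_add_tot hℓ hf0 hf1, hg.eq_add_tot hℓ hg0 hg1, hf.eq_of_hasValueAt_zero hℓ hf0,
    hg.eq_of_hasValueAt_zero hℓ hg0, inner_add_right, inner_smul_right, inner_add_left,
    inner_smul_left, inner_one_right, ← tot_apply, map_add]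
  linear_combination h

/-! ### Compactness of the primitive operator, and its lack of eigenvalues -/

/-- The primitive operator is compact, by the Arzelà-Ascoli theorem. -/
lemma isCompactOperator_J (hℓ : 0 < ℓ) : IsCompactOperator (J ℓ) := by
  let r : L2 ℓ → BoundedContinuousFunction (Icc (0 : ℝ) ℓ) ℂ := fun f =>
    (primBCF f).compContinuous ⟨Subtype.val, continuous_subtype_val⟩
  let ψ : BoundedContinuousFunction (Icc (0 : ℝ) ℓ) ℂ → L2 ℓ := fun g =>
    BoundedContinuousFunction.toLp 2 (volume.restrict (Ioo 0 ℓ)) ℂ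
      (g.compContinuous ⟨projIcc 0 ℓ hℓ.le, continuous_projIcc⟩)
  have hψ : Continuous ψ :=
    (ContinuousLinearMap.continuous _).comp (BoundedContinuousFunction.continuous_compContinuous _)
  have hψr : ∀ f, ψ (r f) = J ℓ f := by
    intro f
    refine Lp.ext ?_
    filter_upwards [coeFn_J f, BoundedContinuousFunction.coeFn_toLp 2
      (volume.restrict (Ioo 0 ℓ)) ℂ ((r f).compContinuous
        ⟨projIcc 0 ℓ hℓ.le, continuous_projIcc⟩), ae_restrict_mem measurableSet_Ioo]
      with x h1 h2 hx
    rw [h1, h2]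
    change prim f (projIcc 0 ℓ hℓ.le x) = prim f x
    rw [projIcc_of_mem hℓ.le (Ioo_subset_Icc_self hx)]
  have hK : IsCompact (closure (r '' Metric.closedBall 0 1)) := by
    refine BoundedContinuousFunction.arzela_ascoli (Metric.closedBall 0 ‖one ℓ‖)
      (isCompact_closedBall _ _) _ ?_ ?_
    · rintro _ x ⟨f, hf, rfl⟩
      rw [mem_closedBall_zero_iff] at hf ⊢
      exact (norm_prim_le f x).trans (mul_le_of_le_one_right (norm_nonneg _) hf)
    · intro x
      rw [Metric.equicontinuousAt_iff]
      intro ε hε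
      obtain ⟨δ, hδ, h⟩ := Metric.continuous_iff.1 (continuous_cutoff (ℓ := ℓ)) x ε hε
      refine ⟨δ, hδ, ?_⟩
      rintro y hy ⟨_, f, hf, rfl⟩
      change dist (prim f x) (prim f y) < ε
      rw [mem_closedBall_zero_iff] at hf
      rw [dist_comm, dist_eq_norm, prim, prim, ← inner_sub_left]
      refine (norm_inner_le_norm _ _).trans_lt ?_
      refine (mul_le_of_le_one_right (norm_nonneg _) hf).trans_lt ?_
      rw [← dist_eq_norm]
      exact h y hy
  refine ⟨ψ '' closure (r '' Metric.closedBall 0 1), hK.image hψ, ?_⟩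
  filter_upwards [Metric.closedBall_mem_nhds (0 : L2 ℓ) one_pos] with f hf
  exact ⟨r f, subset_closure ⟨f, hf, rfl⟩, hψr f⟩

/-- The primitive operator is a Volterra operator: it has no nonzero eigenvalue. -/
lemma eq_zero_of_eq_smul_J {c : ℂ} {g : L2 ℓ} (h : g = c • J ℓ g) : g = 0 := by
  set G : ℝ → ℂ := fun x => c * prim g x with hG
  have hGc : Continuous G := continuous_const.mul (continuous_prim g)
  have hgG : g =ᵐ[volume.restrict (Ioo (0 : ℝ) ℓ)] G := by
    have h1 := Lp.coeFn_smul c (J ℓ g)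
    rw [← h] at h1
    filter_upwards [h1, coeFn_J g] with x h2 h3
    rw [h2, Pi.smul_apply, h3, smul_eq_mul]
  -- the continuous representative solves `G' = c G`, `G(0) = 0`
  set U : ℝ → ℂ := fun x => c * ∫ t in (0 : ℝ)..x, G t with hU
  have hGU : ∀ x ∈ Icc 0 ℓ, G x = U x := fun x hx => by
    rw [hG, hU]
    simp only
    rw [prim_eq_intervalIntegral hgG hx]
  have hd : ∀ x, HasDerivAt U (c * G x) x := fun x =>
    (hGc.integral_hasStrictDerivAt 0 x).hasDerivAt.const_mul c
  have hz : ∀ x ∈ Icc 0 ℓ, U x = 0 := by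
    intro x hx
    have h1 := norm_le_gronwallBound_of_norm_deriv_right_le (f := U) (f' := fun x => c * G x)
      (δ := 0) (K := ‖c‖) (ε := 0) (a := 0) (b := ℓ)
      (fun x _ => (hd x).continuousAt.continuousWithinAt) (fun x _ => (hd x).hasDerivWithinAt)
      (by simp [hU]) (fun x hx => by rw [norm_mul, hGU x (Ico_subset_Icc_self hx), add_zero]) x hx
    rw [gronwallBound_ε0_δ0] at h1
    exact norm_le_zero_iff.1 h1
  refine Lp.ext ?_
  filter_upwards [hgG, Lp.coeFn_zero ℂ 2 (volume.restrict (Ioo (0 : ℝ) ℓ)),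
    ae_restrict_mem measurableSet_Ioo] with x h1 h2 hx
  rw [h1, h2, hGU x (Ioo_subset_Icc_self hx), hz x (Ioo_subset_Icc_self hx), Pi.zero_apply]

end Primitive

section Primitive

variable {ℓ : ℝ}

/-! ### The primitive operator with base point `ℓ` -/

/-- The primitive operator `(N f)(x) = -∫ₓ^ℓ f` with base point `ℓ`. -/
def N (ℓ : ℝ) : L2 ℓ →L[ℂ] L2 ℓ := J ℓ - (tot ℓ).smulRight (one ℓ)

lemma N_apply (f : L2 ℓ) : N ℓ f = (-tot ℓ f) • one ℓ + J ℓ f := by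
  change J ℓ f - tot ℓ f • one ℓ = _
  module

lemma isWeakDeriv_N (hℓ : 0 < ℓ) (f : L2 ℓ) : IsWeakDeriv (N ℓ f) f := by
  rw [N_apply]
  exact isWeakDeriv_smul_one_add_J hℓ _ f

lemma hasValueAt_N_zero (f : L2 ℓ) : HasValueAt (N ℓ f) 0 (-tot ℓ f) := by
  rw [N_apply]
  exact hasValueAt_smul_one_add_J_zero _ f

lemma hasValueAt_N_right (f : L2 ℓ) : HasValueAt (N ℓ f) ℓ 0 := by
  have h := hasValueAt_smul_one_add_J_right (-tot ℓ f) f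
  rwa [← N_apply, neg_add_cancel] at h

lemma IsWeakDeriv.eq_N (hℓ : 0 < ℓ) {f g : L2 ℓ} (h : IsWeakDeriv f g) (h0 : HasValueAt f ℓ 0) :
    f = N ℓ g := by
  obtain ⟨a, ha, ha'⟩ := h.exists_hasValueAt hℓ
  have e := h0.unique hℓ (right_mem_Icc.2 hℓ.le) ha'
  rw [N_apply, h.eq_of_hasValueAt_zero hℓ ha, eq_neg_of_add_eq_zero_left e.symm]

lemma IsWeakDeriv.eq_J (hℓ : 0 < ℓ) {f g : L2 ℓ} (h : IsWeakDeriv f g) (h0 : HasValueAt f 0 0) :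
    f = J ℓ g := by
  rw [h.eq_of_hasValueAt_zero hℓ h0, zero_smul, zero_add]

/-- The adjoint of `N` is `-J`. -/
lemma inner_N_right (f g : L2 ℓ) : inner ℂ f (N ℓ g) = -inner ℂ (J ℓ f) g := by
  rw [N_apply, inner_add_right, inner_smul_right, inner_one_right]
  linear_combination inner_J_add_inner_J f g

lemma tot_J_N_one : tot ℓ (J ℓ (N ℓ (one ℓ))) = -((‖N ℓ (one ℓ)‖ ^ 2 : ℝ) : ℂ) := by
  have h := inner_N_right (N ℓ (one ℓ)) (one ℓ)
  rw [inner_one_right, inner_self_eq_norm_sq_to_K] at h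
  have h2 := congrArg conj h
  rw [map_neg, Complex.conj_conj, map_pow] at h2
  rw [eq_comm, neg_eq_iff_eq_neg, ← h2]
  push_cast
  congr 1
  exact (Complex.conj_ofReal _).symm

lemma isCompactOperator_smulRight {E F : Type*} [NormedAddCommGroup E] [NormedSpace ℂ E]
    [NormedAddCommGroup F] [NormedSpace ℂ F] (φ : E →L[ℂ] ℂ) (x : F) :
    IsCompactOperator (φ.smulRight x) :=
  (isCompactOperator_of_locallyCompactSpace_dom φ).clm_comp
    (ContinuousLinearMap.toSpanSingleton ℂ x)

lemma isCompactOperator_prodMk {E F G : Type*} [TopologicalSpace E] [Zero E]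
    [TopologicalSpace F] [TopologicalSpace G] {f : E → F} {g : E → G} (hf : IsCompactOperator f)
    (hg : IsCompactOperator g) : IsCompactOperator fun x => (f x, g x) := by
  obtain ⟨K, hK, h1⟩ := hf
  obtain ⟨L, hL, h2⟩ := hg
  refine ⟨K ×ˢ L, hK.prod hL, ?_⟩
  filter_upwards [h1, h2] with x h3 h4
  exact ⟨h3, h4⟩

lemma isCompactOperator_N (hℓ : 0 < ℓ) : IsCompactOperator (N ℓ) :=
  (isCompactOperator_J hℓ).sub (isCompactOperator_smulRight _ _)

end Primitive

/-! ### Coordinates on the energy space -/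

section Coordinates

variable {P : Params}

lemma mk_mem_V {p : L2 P.ℓ₁} {r : L2 P.ℓ₂} (h : tot P.ℓ₁ p = tot P.ℓ₂ (J P.ℓ₂ r)) :
    (N P.ℓ₁ p, N P.ℓ₂ (J P.ℓ₂ r)) ∈ V P := by
  refine ⟨⟨p, Submodule.mem_top, isWeakDeriv_N P.ℓ₁_pos p⟩,
    ⟨J P.ℓ₂ r, ⟨r, Submodule.mem_top, isWeakDeriv_J r⟩, isWeakDeriv_N P.ℓ₂_pos _⟩,
    hasValueAt_N_right p, hasValueAt_N_right _,
    ⟨-tot P.ℓ₁ p, hasValueAt_N_zero p, ?_⟩, ?_⟩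
  · rw [h]
    exact hasValueAt_N_zero _
  · rw [(isWeakDeriv_N P.ℓ₂_pos _).wderiv_eq]
    exact hasValueAt_J_zero r

lemma V.fst_eq {f : L2 P.ℓ₁ × L2 P.ℓ₂} (hf : f ∈ V P) : f.1 = N P.ℓ₁ (wderiv f.1) :=
  (isWeakDeriv_wderiv hf.1).eq_N P.ℓ₁_pos hf.2.2.1

lemma V.wderiv_snd_eq {f : L2 P.ℓ₁ × L2 P.ℓ₂} (hf : f ∈ V P) :
    wderiv f.2 = J P.ℓ₂ (wderivN 2 f.2) :=
  (isWeakDeriv_wderiv (wderiv_mem hf.2.1)).eq_J P.ℓ₂_pos hf.2.2.2.2.2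

lemma V.snd_eq {f : L2 P.ℓ₁ × L2 P.ℓ₂} (hf : f ∈ V P) :
    f.2 = N P.ℓ₂ (J P.ℓ₂ (wderivN 2 f.2)) := by
  rw [← V.wderiv_snd_eq hf]
  exact (isWeakDeriv_wderiv hf.2.1).eq_N P.ℓ₂_pos hf.2.2.2.1

lemma V.tot_eq {f : L2 P.ℓ₁ × L2 P.ℓ₂} (hf : f ∈ V P) :
    tot P.ℓ₁ (wderiv f.1) = tot P.ℓ₂ (J P.ℓ₂ (wderivN 2 f.2)) := by
  rw [← V.wderiv_snd_eq hf]
  obtain ⟨c, h1, h2⟩ := hf.2.2.2.2.1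
  have e1 := (isWeakDeriv_wderiv hf.1).eq_add_tot P.ℓ₁_pos h1 hf.2.2.1
  have e2 := (isWeakDeriv_wderiv hf.2.1).eq_add_tot P.ℓ₂_pos h2 hf.2.2.2.1
  linear_combination e2 - e1

/-- The space of the sextuples `(p, r, v₁, v₂, θ₁, q₁)` of `L²`-functions. An element
`(u, v, θ₁, q₁)` of the energy space is represented by `p = ∂ₓ u₁`, `r = ∂ₓ² u₂` and its other
components. -/
abbrev Coord (P : Params) : Type :=
  L2 P.ℓ₁ × L2 P.ℓ₂ × L2 P.ℓ₁ × L2 P.ℓ₂ × L2 P.ℓ₁ × L2 P.ℓ₁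

/-- The closed subspace of the sextuples with `∫₀^ℓ₁ p = ∫₀^ℓ₂ ∫₀ˣ r`, which expresses the
transmission condition `u₁(0) = u₂(0)`. -/
def coordSubspace (P : Params) : Submodule ℂ (Coord P) where
  carrier := {x | tot P.ℓ₁ x.1 = tot P.ℓ₂ (J P.ℓ₂ x.2.1)}
  zero_mem' := by simp
  add_mem' {x y} hx hy := by
    change tot P.ℓ₁ (x.1 + y.1) = tot P.ℓ₂ (J P.ℓ₂ (x.2.1 + y.2.1))
    rw [map_add, map_add, map_add]
    exact congrArg₂ _ hx hy
  smul_mem' c x hx := by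
    change tot P.ℓ₁ (c • x.1) = tot P.ℓ₂ (J P.ℓ₂ (c • x.2.1))
    rw [map_smul, map_smul, map_smul]
    exact congrArg _ hx

lemma isClosed_coordSubspace : IsClosed (coordSubspace P : Set (Coord P)) :=
  isClosed_eq (f := fun x : Coord P => tot P.ℓ₁ x.1)
    (g := fun x : Coord P => tot P.ℓ₂ (J P.ℓ₂ x.2.1)) (by fun_prop) (by fun_prop)

/-- The linear equivalence between the energy space and the subspace of compatible sextuples. -/
def coordLinearEquiv (P : Params) : EnergySpace P ≃ₗ[ℂ] coordSubspace P where
  toFun y := ⟨(wderiv y.u₁, wderivN 2 y.u₂, y.v₁, y.v₂, y.θ₁, y.q₁), V.tot_eq y.u_mem⟩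
  map_add' y z := by
    refine Subtype.ext (Prod.ext (wderiv_add y.u₁_mem z.u₁_mem)
      (Prod.ext (wderivN_add 2 y.u₂_mem z.u₂_mem) rfl))
  map_smul' c y := by
    refine Subtype.ext (Prod.ext (wderiv_smul c y.u₁_mem)
      (Prod.ext (wderivN_smul 2 c y.u₂_mem) rfl))
  invFun x := EnergySpace.mk ⟨_, mk_mem_V x.2⟩ x.1.2.2.1 x.1.2.2.2.1 x.1.2.2.2.2.1 x.1.2.2.2.2.2
  left_inv y := EnergySpace.ext (V.fst_eq y.u_mem).symm (V.snd_eq y.u_mem).symm rfl rfl rfl rfl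
  right_inv x := by
    refine Subtype.ext (Prod.ext (isWeakDeriv_N P.ℓ₁_pos _).wderiv_eq (Prod.ext ?_ rfl))
    change wderiv (wderiv (N P.ℓ₂ (J P.ℓ₂ x.1.2.1))) = x.1.2.1
    rw [(isWeakDeriv_N P.ℓ₂_pos _).wderiv_eq, (isWeakDeriv_J _).wderiv_eq]

lemma norm_le_of_mul_sq_le {c a b : ℝ} (hc : 0 < c) (hb : 0 ≤ b) (h : c * a ^ 2 ≤ b ^ 2) :
    a ≤ (√c)⁻¹ * b := by
  rw [inv_mul_eq_div, le_div_iff₀ (Real.sqrt_pos.2 hc)]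
  refine le_of_sq_le_sq ?_ hb
  rw [mul_pow, Real.sq_sqrt hc.le]
  linarith

lemma continuous_coordLinearEquiv : Continuous (coordLinearEquiv P) := by
  have := P.α₁_pos
  have := P.α₂_pos
  have := P.β₁_pos
  have := P.γ₁_pos
  have := P.δ₁_pos
  have := P.τ₁_pos
  have := P.κ₁_pos
  have key : ∀ {F : Type} [NormedAddCommGroup F] [NormedSpace ℂ F] (f : EnergySpace P →ₗ[ℂ] F)
      (c : ℝ), 0 < c → (∀ y, c * ‖f y‖ ^ 2 ≤ ‖y‖ ^ 2) → Continuous f := by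
    intro F _ _ f c hc h
    exact AddMonoidHomClass.continuous_of_bound f _ fun y =>
      norm_le_of_mul_sq_le hc (norm_nonneg y) (h y)
  have e : ∀ y : EnergySpace P,
      0 ≤ P.δ₁ * P.α₁ / P.β₁ * ‖wderiv y.u₁‖ ^ 2 ∧ 0 ≤ P.δ₁ / P.β₁ * ‖y.v₁‖ ^ 2 ∧
      0 ≤ ‖y.θ₁‖ ^ 2 ∧ 0 ≤ P.γ₁ * P.τ₁ / P.κ₁ * ‖y.q₁‖ ^ 2 ∧
      0 ≤ P.α₂ * ‖wderivN 2 y.u₂‖ ^ 2 ∧ 0 ≤ ‖y.v₂‖ ^ 2 := fun y => by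
    refine ⟨?_, ?_, ?_, ?_, ?_, ?_⟩ <;> positivity
  let Φ : EnergySpace P →ₗ[ℂ] Coord P :=
    (coordSubspace P).subtype ∘ₗ (coordLinearEquiv P).toLinearMap
  have c1 := key (LinearMap.fst _ _ _ ∘ₗ Φ) (P.δ₁ * P.α₁ / P.β₁) (by positivity) fun y => by
    change P.δ₁ * P.α₁ / P.β₁ * ‖wderiv y.u₁‖ ^ 2 ≤ _
    obtain ⟨e1, e2, e3, e4, e5, e6⟩ := e y
    rw [EnergySpace.norm_sq_eq]
    linarith
  have c2 := key (LinearMap.fst _ _ _ ∘ₗ LinearMap.snd _ _ _ ∘ₗ Φ) P.α₂ (by positivity)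
    fun y => by
    change P.α₂ * ‖wderivN 2 y.u₂‖ ^ 2 ≤ _
    obtain ⟨e1, e2, e3, e4, e5, e6⟩ := e y
    rw [EnergySpace.norm_sq_eq]
    linarith
  have c3 := key (LinearMap.fst _ _ _ ∘ₗ LinearMap.snd _ _ _ ∘ₗ LinearMap.snd _ _ _ ∘ₗ Φ)
    (P.δ₁ / P.β₁) (by positivity) fun y => by
    change P.δ₁ / P.β₁ * ‖y.v₁‖ ^ 2 ≤ _
    obtain ⟨e1, e2, e3, e4, e5, e6⟩ := e y
    rw [EnergySpace.norm_sq_eq]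
    linarith
  have c4 := key (LinearMap.fst _ _ _ ∘ₗ LinearMap.snd _ _ _ ∘ₗ LinearMap.snd _ _ _ ∘ₗ
    LinearMap.snd _ _ _ ∘ₗ Φ) 1 (by positivity) fun y => by
    change 1 * ‖y.v₂‖ ^ 2 ≤ _
    obtain ⟨e1, e2, e3, e4, e5, e6⟩ := e y
    rw [EnergySpace.norm_sq_eq]
    linarith
  have c5 := key (LinearMap.fst _ _ _ ∘ₗ LinearMap.snd _ _ _ ∘ₗ LinearMap.snd _ _ _ ∘ₗ
    LinearMap.snd _ _ _ ∘ₗ LinearMap.snd _ _ _ ∘ₗ Φ) 1 (by positivity) fun y => by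
    change 1 * ‖y.θ₁‖ ^ 2 ≤ _
    obtain ⟨e1, e2, e3, e4, e5, e6⟩ := e y
    rw [EnergySpace.norm_sq_eq]
    linarith
  have c6 := key (LinearMap.snd _ _ _ ∘ₗ LinearMap.snd _ _ _ ∘ₗ LinearMap.snd _ _ _ ∘ₗ
    LinearMap.snd _ _ _ ∘ₗ LinearMap.snd _ _ _ ∘ₗ Φ) (P.γ₁ * P.τ₁ / P.κ₁) (by positivity)
    fun y => by
    change P.γ₁ * P.τ₁ / P.κ₁ * ‖y.q₁‖ ^ 2 ≤ _
    obtain ⟨e1, e2, e3, e4, e5, e6⟩ := e y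
    rw [EnergySpace.norm_sq_eq]
    linarith
  exact Continuous.subtype_mk
    (c1.prodMk (c2.prodMk (c3.prodMk (c4.prodMk (c5.prodMk c6))))) _

lemma continuous_coordLinearEquiv_symm : Continuous (coordLinearEquiv P).symm := by
  have := P.α₁_pos
  have := P.α₂_pos
  have := P.β₁_pos
  have := P.γ₁_pos
  have := P.δ₁_pos
  have := P.τ₁_pos
  have := P.κ₁_pos
  refine AddMonoidHomClass.continuous_of_bound (coordLinearEquiv P).symm
    (√(P.δ₁ * P.α₁ / P.β₁ + P.δ₁ / P.β₁ + 1 + P.γ₁ * P.τ₁ / P.κ₁ + P.α₂ + 1)) fun x => ?_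
  obtain ⟨y, rfl⟩ := (coordLinearEquiv P).surjective x
  rw [LinearEquiv.symm_apply_apply]
  refine le_of_sq_le_sq ?_ (by positivity)
  rw [mul_pow, Real.sq_sqrt (by positivity), EnergySpace.norm_sq_eq]
  set x := coordLinearEquiv P y with hx
  have h0 : ‖x.1‖ = ‖x‖ := rfl
  have h1 : ‖wderiv y.u₁‖ ≤ ‖x‖ := h0 ▸ norm_fst_le x.1
  have a1 : ‖x.1.2‖ ≤ ‖x‖ := h0 ▸ norm_snd_le x.1
  have h2 : ‖wderivN 2 y.u₂‖ ≤ ‖x‖ := (norm_fst_le x.1.2).trans a1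
  have a2 : ‖x.1.2.2‖ ≤ ‖x‖ := (norm_snd_le x.1.2).trans a1
  have h3 : ‖y.v₁‖ ≤ ‖x‖ := (norm_fst_le x.1.2.2).trans a2
  have a3 : ‖x.1.2.2.2‖ ≤ ‖x‖ := (norm_snd_le x.1.2.2).trans a2
  have h4 : ‖y.v₂‖ ≤ ‖x‖ := (norm_fst_le x.1.2.2.2).trans a3
  have a4 : ‖x.1.2.2.2.2‖ ≤ ‖x‖ := (norm_snd_le x.1.2.2.2).trans a3
  have h5 : ‖y.θ₁‖ ≤ ‖x‖ := (norm_fst_le x.1.2.2.2.2).trans a4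
  have h6 : ‖y.q₁‖ ≤ ‖x‖ := (norm_snd_le x.1.2.2.2.2).trans a4
  simp only [add_mul, one_mul]
  gcongr

/-- The energy space is isomorphic, as a topological vector space, to the closed subspace of the
compatible sextuples in a product of `L²`-spaces. -/
def coordEquiv (P : Params) : EnergySpace P ≃L[ℂ] coordSubspace P where
  toLinearEquiv := coordLinearEquiv P
  continuous_toFun := continuous_coordLinearEquiv
  continuous_invFun := continuous_coordLinearEquiv_symm

instance : CompleteSpace (EnergySpace P) := by
  have : CompleteSpace (coordSubspace P) := isClosed_coordSubspace.completeSpace_coe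
  exact (completeSpace_congr (e := (coordEquiv P).toEquiv) (coordEquiv P).isUniformEmbedding).2 this

end Coordinates

/-! ### The inverse of the operator -/

section Inverse

variable {P : Params}

-- The component maps below describe the solution `y = (u, v, θ₁, q₁)` of `A₁ y = F` as a function
-- of the coordinates `x = (∂ₓ f₁, ∂ₓ² f₂, g₁, g₂, h, k)` of `F = (f, g, h, k)`.

/-- The derivative `∂ₓ q₁` of the heat flux. -/
def solDq (P : Params) : Coord P →L[ℂ] L2 P.ℓ₁ :=
  -(((1 / P.γ₁ : ℝ) : ℂ) • (.fst ℂ _ _ ∘L .snd ℂ _ _ ∘L .snd ℂ _ _ ∘L .snd ℂ _ _ ∘L .snd ℂ _ _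
    + (P.δ₁ : ℂ) • .fst ℂ _ _))

/-- The heat flux at `x = 0`, chosen such that `∂ₓ θ₁` has mean zero. -/
def solQzero (P : Params) : Coord P →L[ℂ] ℂ :=
  -(((1 / P.ℓ₁ : ℝ) : ℂ) • (tot P.ℓ₁ ∘L ((P.τ₁ : ℂ) • (.snd ℂ _ _ ∘L .snd ℂ _ _ ∘L .snd ℂ _ _ ∘L
    .snd ℂ _ _ ∘L .snd ℂ _ _) + J P.ℓ₁ ∘L solDq P)))

/-- The heat flux `q₁`. -/
def solQ (P : Params) : Coord P →L[ℂ] L2 P.ℓ₁ :=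
  (solQzero P).smulRight (one P.ℓ₁) + J P.ℓ₁ ∘L solDq P

/-- The derivative `∂ₓ θ₁` of the temperature. -/
def solDθ (P : Params) : Coord P →L[ℂ] L2 P.ℓ₁ :=
  -(((1 / P.κ₁ : ℝ) : ℂ) • ((P.τ₁ : ℂ) • (.snd ℂ _ _ ∘L .snd ℂ _ _ ∘L .snd ℂ _ _ ∘L
    .snd ℂ _ _ ∘L .snd ℂ _ _) + solQ P))

/-- The second derivative `∂ₓ² u₁` of the displacement of the string. -/
def solD2u₁ (P : Params) : Coord P →L[ℂ] L2 P.ℓ₁ :=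
  ((1 / P.α₁ : ℝ) : ℂ) • (.fst ℂ _ _ ∘L .snd ℂ _ _ ∘L .snd ℂ _ _ + (P.β₁ : ℂ) • solDθ P)

/-- The fourth derivative `∂ₓ⁴ u₂` of the displacement of the beam. -/
def solD4u₂ (P : Params) : Coord P →L[ℂ] L2 P.ℓ₂ :=
  -(((1 / P.α₂ : ℝ) : ℂ) • (.fst ℂ _ _ ∘L .snd ℂ _ _ ∘L .snd ℂ _ _ ∘L .snd ℂ _ _))

/-- The ratio `∂ₓ³ u₂(0) / ∂ₓ u₁(0)` prescribed by the transmission condition. -/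
def ratio (P : Params) : ℝ := P.δ₁ / P.β₁ * P.α₁ / P.α₂

lemma ratio_pos (P : Params) : 0 < ratio P := by
  have := P.α₁_pos
  have := P.α₂_pos
  have := P.β₁_pos
  have := P.δ₁_pos
  unfold ratio
  positivity

/-- The determinant of the scalar equation for `∂ₓ u₁(0)`. -/
def det (P : Params) : ℝ := P.ℓ₁ + ratio P * ‖N P.ℓ₂ (one P.ℓ₂)‖ ^ 2

lemma det_pos (P : Params) : 0 < det P := by
  have := P.ℓ₁_pos
  have := ratio_pos P
  unfold det
  positivity

/-- The strain `∂ₓ u₁(0)`, chosen such that `u₁(0) = u₂(0)`. -/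
def solDu₁zero (P : Params) : Coord P →L[ℂ] ℂ :=
  (((det P)⁻¹ : ℝ) : ℂ) • (tot P.ℓ₂ ∘L J P.ℓ₂ ∘L N P.ℓ₂ ∘L J P.ℓ₂ ∘L solD4u₂ P
    - tot P.ℓ₁ ∘L J P.ℓ₁ ∘L solD2u₁ P)

/-- The derivative `∂ₓ u₁` of the displacement of the string. -/
def solDu₁ (P : Params) : Coord P →L[ℂ] L2 P.ℓ₁ :=
  (solDu₁zero P).smulRight (one P.ℓ₁) + J P.ℓ₁ ∘L solD2u₁ P

/-- The third derivative `∂ₓ³ u₂` of the displacement of the beam. -/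
def solD3u₂ (P : Params) : Coord P →L[ℂ] L2 P.ℓ₂ :=
  (((ratio P : ℝ) : ℂ) • solDu₁zero P).smulRight (one P.ℓ₂) + J P.ℓ₂ ∘L solD4u₂ P

/-- The coordinates of the solution `y` of `A₁ y = F`, in terms of those of `F`. -/
def solCoord (P : Params) : Coord P →L[ℂ] Coord P :=
  (solDu₁ P).prod ((N P.ℓ₂ ∘L solD3u₂ P).prod ((N P.ℓ₁ ∘L .fst ℂ _ _).prod
    ((N P.ℓ₂ ∘L J P.ℓ₂ ∘L .fst ℂ _ _ ∘L .snd ℂ _ _).prod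
      ((J P.ℓ₁ ∘L solDθ P).prod (solQ P)))))

lemma solQ_apply (x : Coord P) :
    solQ P x = solQzero P x • one P.ℓ₁ + J P.ℓ₁ (solDq P x) := rfl

lemma solDu₁_apply (x : Coord P) :
    solDu₁ P x = solDu₁zero P x • one P.ℓ₁ + J P.ℓ₁ (solD2u₁ P x) := rfl

lemma solD3u₂_apply (x : Coord P) : solD3u₂ P x =
    (((ratio P : ℝ) : ℂ) * solDu₁zero P x) • one P.ℓ₂ + J P.ℓ₂ (solD4u₂ P x) := rfl

lemma solDq_apply (x : Coord P) :
    solDq P x = -(((1 / P.γ₁ : ℝ) : ℂ) • (x.2.2.2.2.1 + (P.δ₁ : ℂ) • x.1)) := rfl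

lemma solQzero_apply (x : Coord P) : solQzero P x =
    -(((1 / P.ℓ₁ : ℝ) : ℂ) * tot P.ℓ₁ ((P.τ₁ : ℂ) • x.2.2.2.2.2 + J P.ℓ₁ (solDq P x))) := rfl

lemma solDθ_apply (x : Coord P) :
    solDθ P x = -(((1 / P.κ₁ : ℝ) : ℂ) • ((P.τ₁ : ℂ) • x.2.2.2.2.2 + solQ P x)) := rfl

lemma solD2u₁_apply (x : Coord P) : solD2u₁ P x =
    ((1 / P.α₁ : ℝ) : ℂ) • (x.2.2.1 + (P.β₁ : ℂ) • solDθ P x) := rfl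

lemma solD4u₂_apply (x : Coord P) :
    solD4u₂ P x = -(((1 / P.α₂ : ℝ) : ℂ) • x.2.2.2.1) := rfl

lemma solDu₁zero_apply (x : Coord P) : solDu₁zero P x = (((det P)⁻¹ : ℝ) : ℂ) *
    (tot P.ℓ₂ (J P.ℓ₂ (N P.ℓ₂ (J P.ℓ₂ (solD4u₂ P x)))) - tot P.ℓ₁ (J P.ℓ₁ (solD2u₁ P x))) := rfl

lemma tot_solDθ (x : Coord P) : tot P.ℓ₁ (solDθ P x) = 0 := by
  have hℓ : (P.ℓ₁ : ℂ) ≠ 0 := Complex.ofReal_ne_zero.2 P.ℓ₁_pos.ne'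
  rw [solDθ_apply, solQ_apply, solQzero_apply]
  simp only [map_neg, map_smul, map_add, tot_one P.ℓ₁_pos, smul_eq_mul]
  push_cast
  field_simp
  ring

lemma ofReal_det : ((det P : ℝ) : ℂ) = P.ℓ₁ - ratio P * tot P.ℓ₂ (J P.ℓ₂ (N P.ℓ₂ (one P.ℓ₂))) := by
  rw [tot_J_N_one, det]
  push_cast
  ring

lemma solCoord_mem (x : Coord P) : solCoord P x ∈ coordSubspace P := by
  change tot P.ℓ₁ (solDu₁ P x) = tot P.ℓ₂ (J P.ℓ₂ (N P.ℓ₂ (solD3u₂ P x)))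
  have hdet : ((det P : ℝ) : ℂ) ≠ 0 := Complex.ofReal_ne_zero.2 (det_pos P).ne'
  have h0 : ((det P : ℝ) : ℂ) * solDu₁zero P x =
      tot P.ℓ₂ (J P.ℓ₂ (N P.ℓ₂ (J P.ℓ₂ (solD4u₂ P x)))) - tot P.ℓ₁ (J P.ℓ₁ (solD2u₁ P x)) := by
    rw [solDu₁zero_apply, Complex.ofReal_inv, mul_inv_cancel_left₀ hdet]
  rw [ofReal_det] at h0
  rw [solDu₁_apply, solD3u₂_apply]
  simp only [map_add, map_smul, tot_one P.ℓ₁_pos, smul_eq_mul]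
  linear_combination h0

lemma isCompactOperator_J_comp {ℓ : ℝ} (hℓ : 0 < ℓ) {E : Type*} [NormedAddCommGroup E]
    [NormedSpace ℂ E] (f : E →L[ℂ] L2 ℓ) : IsCompactOperator (J ℓ ∘L f) :=
  (isCompactOperator_J hℓ).comp_clm f

lemma isCompactOperator_solCoord : IsCompactOperator (solCoord P) := by
  have c1 : IsCompactOperator (solDu₁ P) :=
    (isCompactOperator_smulRight _ _).add (isCompactOperator_J_comp P.ℓ₁_pos _)
  have c2 : IsCompactOperator (N P.ℓ₂ ∘L solD3u₂ P) :=
    (isCompactOperator_N P.ℓ₂_pos).comp_clm _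
  have c3 : IsCompactOperator
      (N P.ℓ₁ ∘L .fst ℂ _ (L2 P.ℓ₂ × L2 P.ℓ₁ × L2 P.ℓ₂ × L2 P.ℓ₁ × L2 P.ℓ₁)) :=
    (isCompactOperator_N P.ℓ₁_pos).comp_clm _
  have c4 : IsCompactOperator (N P.ℓ₂ ∘L J P.ℓ₂ ∘L .fst ℂ _ (L2 P.ℓ₁ × L2 P.ℓ₂ × L2 P.ℓ₁ × L2 P.ℓ₁)
      ∘L .snd ℂ (L2 P.ℓ₁) _) :=
    (isCompactOperator_N P.ℓ₂_pos).comp_clm _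
  have c5 : IsCompactOperator (solQ P) :=
    (isCompactOperator_smulRight _ _).add (isCompactOperator_J_comp P.ℓ₁_pos _)
  exact isCompactOperator_prodMk c1 (isCompactOperator_prodMk c2 (isCompactOperator_prodMk c3
    (isCompactOperator_prodMk c4
      (isCompactOperator_prodMk (isCompactOperator_J_comp P.ℓ₁_pos _) c5))))

/-- The inverse of the operator `A₁`. -/
def inverseA (P : Params) : EnergySpace P →L[ℂ] EnergySpace P :=
  ((coordEquiv P).symm : coordSubspace P →L[ℂ] EnergySpace P) ∘L
    ((solCoord P).codRestrict (coordSubspace P) solCoord_mem ∘L (coordSubspace P).subtypeL) ∘L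
    ((coordEquiv P) : EnergySpace P →L[ℂ] coordSubspace P)

lemma isCompactOperator_inverseA : IsCompactOperator (inverseA P) := by
  have h1 := isCompactOperator_solCoord.codRestrict (V := coordSubspace P) solCoord_mem
    isClosed_coordSubspace
  exact ((h1.comp_clm (coordSubspace P).subtypeL).comp_clm
    ((coordEquiv P) : EnergySpace P →L[ℂ] coordSubspace P)).clm_comp
    ((coordEquiv P).symm : coordSubspace P →L[ℂ] EnergySpace P)

/-- The coordinates of an element of the energy space. -/
def coords (F : EnergySpace P) : Coord P := (coordEquiv P F).1

lemma inverseA_v₁ (F : EnergySpace P) : (inverseA P F).v₁ = F.u₁ := (V.fst_eq F.u_mem).symm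

lemma inverseA_v₂ (F : EnergySpace P) : (inverseA P F).v₂ = F.u₂ := (V.snd_eq F.u_mem).symm

lemma inverseA_q₁ (F : EnergySpace P) : (inverseA P F).q₁ = solQ P (coords F) := rfl

lemma wderiv_inverseA_u₁ (F : EnergySpace P) :
    wderiv (inverseA P F).u₁ = solDu₁ P (coords F) :=
  (isWeakDeriv_N P.ℓ₁_pos _).wderiv_eq

lemma wderiv_solDu₁ (x : Coord P) : wderiv (solDu₁ P x) = solD2u₁ P x :=
  (isWeakDeriv_smul_one_add_J P.ℓ₁_pos _ _).wderiv_eq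

lemma wderivN_two_inverseA_u₂ (F : EnergySpace P) :
    wderivN 2 (inverseA P F).u₂ = N P.ℓ₂ (solD3u₂ P (coords F)) := by
  change wderiv (wderiv (N P.ℓ₂ (J P.ℓ₂ (N P.ℓ₂ (solD3u₂ P (coords F)))))) = _
  rw [(isWeakDeriv_N P.ℓ₂_pos _).wderiv_eq, (isWeakDeriv_J _).wderiv_eq]

lemma wderivN_three_inverseA_u₂ (F : EnergySpace P) :
    wderivN 3 (inverseA P F).u₂ = solD3u₂ P (coords F) := by
  rw [wderivN, Function.iterate_succ_apply']
  change wderiv (wderivN 2 _) = _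
  rw [wderivN_two_inverseA_u₂, (isWeakDeriv_N P.ℓ₂_pos _).wderiv_eq]

lemma wderivN_four_inverseA_u₂ (F : EnergySpace P) :
    wderivN 4 (inverseA P F).u₂ = solD4u₂ P (coords F) := by
  rw [wderivN, Function.iterate_succ_apply']
  change wderiv (wderivN 3 _) = _
  rw [wderivN_three_inverseA_u₂]
  exact (isWeakDeriv_smul_one_add_J P.ℓ₂_pos _ _).wderiv_eq

lemma inverseA_mem (F : EnergySpace P) : inverseA P F ∈ domA P := by
  have hθ : HasValueAt (J P.ℓ₁ (solDθ P (coords F))) P.ℓ₁ 0 := by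
    have h := hasValueAt_J_right (solDθ P (coords F))
    rwa [tot_solDθ] at h
  refine ⟨⟨_, ⟨_, Submodule.mem_top, isWeakDeriv_smul_one_add_J P.ℓ₁_pos _ _⟩,
      isWeakDeriv_N P.ℓ₁_pos (solDu₁ P (coords F))⟩,
    ⟨_, ⟨_, ⟨_, ⟨_, Submodule.mem_top, isWeakDeriv_smul_one_add_J P.ℓ₂_pos _ _⟩,
      isWeakDeriv_N P.ℓ₂_pos (solD3u₂ P (coords F))⟩, isWeakDeriv_J _⟩, isWeakDeriv_N P.ℓ₂_pos _⟩,
    ?_, ⟨⟨_, Submodule.mem_top, isWeakDeriv_J (solDθ P (coords F))⟩, hasValueAt_J_zero _, hθ⟩,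
    ⟨_, Submodule.mem_top, isWeakDeriv_smul_one_add_J P.ℓ₁_pos _ _⟩, ?_,
    ratio P * solDu₁zero P (coords F), solDu₁zero P (coords F), ?_, ?_, ?_⟩
  · rw [inverseA_v₁, inverseA_v₂]
    exact F.u_mem
  · rw [wderivN_two_inverseA_u₂]
    exact hasValueAt_N_right _
  · rw [wderivN_three_inverseA_u₂]
    exact hasValueAt_smul_one_add_J_zero _ _
  · rw [wderiv_inverseA_u₁]
    exact hasValueAt_smul_one_add_J_zero _ _
  · have h2 : (P.α₂ : ℂ) ≠ 0 := Complex.ofReal_ne_zero.2 P.α₂_pos.ne'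
    rw [ratio]
    push_cast
    field_simp

lemma opA_inverseA (F : EnergySpace P) : opA P ⟨inverseA P F, inverseA_mem F⟩ = F := by
  have hα₁ : (P.α₁ : ℂ) ≠ 0 := Complex.ofReal_ne_zero.2 P.α₁_pos.ne'
  have hα₂ : (P.α₂ : ℂ) ≠ 0 := Complex.ofReal_ne_zero.2 P.α₂_pos.ne'
  have hγ₁ : (P.γ₁ : ℂ) ≠ 0 := Complex.ofReal_ne_zero.2 P.γ₁_pos.ne'
  have hτ₁ : (P.τ₁ : ℂ) ≠ 0 := Complex.ofReal_ne_zero.2 P.τ₁_pos.ne'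
  have hκ₁ : (P.κ₁ : ℂ) ≠ 0 := Complex.ofReal_ne_zero.2 P.κ₁_pos.ne'
  have dθ : wderiv (inverseA P F).θ₁ = solDθ P (coords F) := (isWeakDeriv_J _).wderiv_eq
  have dq : wderiv (inverseA P F).q₁ = solDq P (coords F) :=
    (isWeakDeriv_smul_one_add_J P.ℓ₁_pos _ _).wderiv_eq
  refine EnergySpace.ext (inverseA_v₁ F) (inverseA_v₂ F) ?_ ?_ ?_ ?_
  · change (P.α₁ : ℂ) • wderiv (wderiv (inverseA P F).u₁)
      - (P.β₁ : ℂ) • wderiv (inverseA P F).θ₁ = F.v₁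
    rw [wderiv_inverseA_u₁, wderiv_solDu₁, dθ, solD2u₁_apply]
    change _ • _ • (F.v₁ + _) - _ = _
    rw [smul_smul, show (P.α₁ : ℂ) * ((1 / P.α₁ : ℝ) : ℂ) = 1 by push_cast; field_simp, one_smul,
      add_sub_cancel_right]
  · change -((P.α₂ : ℂ) • wderivN 4 (inverseA P F).u₂) = F.v₂
    rw [wderivN_four_inverseA_u₂, solD4u₂_apply]
    change -(_ • -(_ • F.v₂)) = _
    rw [smul_neg, neg_neg, smul_smul,
      show (P.α₂ : ℂ) * ((1 / P.α₂ : ℝ) : ℂ) = 1 by push_cast; field_simp, one_smul]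
  · change -((P.γ₁ : ℂ) • wderiv (inverseA P F).q₁) - (P.δ₁ : ℂ) • wderiv (inverseA P F).v₁ = F.θ₁
    rw [dq, inverseA_v₁, solDq_apply]
    change -(_ • -(_ • (F.θ₁ + _ • wderiv F.u₁))) - _ = _
    rw [smul_neg, neg_neg, smul_smul,
      show (P.γ₁ : ℂ) * ((1 / P.γ₁ : ℝ) : ℂ) = 1 by push_cast; field_simp, one_smul,
      add_sub_cancel_right]
  · change -(((1 / P.τ₁ : ℝ) : ℂ) • (inverseA P F).q₁)
      - ((P.κ₁ / P.τ₁ : ℝ) : ℂ) • wderiv (inverseA P F).θ₁ = F.q₁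
    rw [dθ, inverseA_q₁, solDθ_apply]
    change _ - _ • -(_ • (_ • F.q₁ + _)) = _
    rw [smul_neg, sub_neg_eq_add, smul_smul, show ((P.κ₁ / P.τ₁ : ℝ) : ℂ) * ((1 / P.κ₁ : ℝ) : ℂ)
      = ((1 / P.τ₁ : ℝ) : ℂ) by push_cast; field_simp, smul_add, smul_smul,
      show ((1 / P.τ₁ : ℝ) : ℂ) * (P.τ₁ : ℂ) = 1 by push_cast; field_simp, one_smul]
    abel

end Inverse

section Dissipation

variable {P : Params}

/-! ### Dissipativity and the kernel -/

/-- The energy is dissipated by the heat flux only: all the other terms cancel after integration by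
parts, the boundary terms at `x = 0` because of the transmission conditions. -/
lemma re_inner_opA {y : EnergySpace P} (hy : y ∈ domA P) :
    (inner ℂ y (opA P ⟨y, hy⟩)).re = -(P.γ₁ / P.κ₁ * ‖y.q₁‖ ^ 2) := by
  obtain ⟨y1, y2, hv, ⟨y4, y5, y6⟩, y7, y8, a, b, y9, y10, y11⟩ := id hy
  obtain ⟨v1, v2, v3, v4, ⟨v0, v5, v6⟩, v7⟩ := hv
  simp only at v1 v2 v3 v4 v5 v6 v7
  have hτ₁ := P.τ₁_pos
  have hκ₁ := P.κ₁_pos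
  have hβ₁ := P.β₁_pos
  have du1 : IsWeakDeriv (wderiv y.u₁) (wderivN 2 y.u₁) := isWeakDeriv_wderiv (wderiv_mem y1)
  have du2 : IsWeakDeriv (wderivN 2 y.u₂) (wderivN 3 y.u₂) :=
    isWeakDeriv_wderiv (wderiv_mem (wderiv_mem y2))
  have du3 : IsWeakDeriv (wderivN 3 y.u₂) (wderivN 4 y.u₂) :=
    isWeakDeriv_wderiv (wderiv_mem (wderiv_mem (wderiv_mem y2)))
  obtain ⟨b', -, hb'⟩ := du1.exists_hasValueAt P.ℓ₁_pos
  obtain ⟨a', -, ha'⟩ := du3.exists_hasValueAt P.ℓ₂_pos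
  obtain ⟨w, hw, -⟩ := du2.exists_hasValueAt P.ℓ₂_pos
  obtain ⟨d, -, hd⟩ := (isWeakDeriv_wderiv (wderiv_mem v2)).exists_hasValueAt P.ℓ₂_pos
  obtain ⟨q, hq, hq'⟩ := (isWeakDeriv_wderiv y7).exists_hasValueAt P.ℓ₁_pos
  have i1 := (isWeakDeriv_wderiv v1).inner_add_inner P.ℓ₁_pos du1 v5 v3 y10 hb'
  have i2 := (isWeakDeriv_wderiv v1).inner_add_inner P.ℓ₁_pos (isWeakDeriv_wderiv y4) v5 v3 y5 y6
  have i3 := (isWeakDeriv_wderiv y7).inner_add_inner P.ℓ₁_pos (isWeakDeriv_wderiv y4) hq hq' y5 y6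
  have i4 := (isWeakDeriv_wderiv v2).inner_add_inner P.ℓ₂_pos du3 v6 v4 y9 ha'
  have i5 := (isWeakDeriv_wderiv (wderiv_mem v2)).inner_add_inner P.ℓ₂_pos du2 v7 hd hw y8
  have hE : inner ℂ y (opA P ⟨y, hy⟩) =
      ((P.δ₁ * P.α₁ / P.β₁ : ℝ) : ℂ) * inner ℂ (wderiv y.u₁) (wderiv y.v₁)
      + ((P.δ₁ / P.β₁ : ℝ) : ℂ) *
        inner ℂ y.v₁ ((P.α₁ : ℂ) • wderivN 2 y.u₁ - (P.β₁ : ℂ) • wderiv y.θ₁)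
      + inner ℂ y.θ₁ (-((P.γ₁ : ℂ) • wderiv y.q₁) - (P.δ₁ : ℂ) • wderiv y.v₁)
      + ((P.γ₁ * P.τ₁ / P.κ₁ : ℝ) : ℂ) * inner ℂ y.q₁
        (-(((1 / P.τ₁ : ℝ) : ℂ) • y.q₁) - ((P.κ₁ / P.τ₁ : ℝ) : ℂ) • wderiv y.θ₁)
      + (P.α₂ : ℂ) * inner ℂ (wderivN 2 y.u₂) (wderivN 2 y.v₂)
      + inner ℂ y.v₂ (-((P.α₂ : ℂ) • wderivN 4 y.u₂)) := rfl
  have s1 : (inner ℂ (wderiv y.u₁) (wderiv y.v₁) : ℂ).re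
      = (inner ℂ (wderiv y.v₁) (wderiv y.u₁) : ℂ).re := by
    rw [← inner_conj_symm, Complex.conj_re]
  have s2 : (inner ℂ y.θ₁ (wderiv y.v₁) : ℂ).re = (inner ℂ (wderiv y.v₁) y.θ₁ : ℂ).re := by
    rw [← inner_conj_symm, Complex.conj_re]
  have s3 : (inner ℂ y.θ₁ (wderiv y.q₁) : ℂ).re = (inner ℂ (wderiv y.q₁) y.θ₁ : ℂ).re := by
    rw [← inner_conj_symm, Complex.conj_re]
  have s4 : (inner ℂ (wderivN 2 y.u₂) (wderivN 2 y.v₂) : ℂ).re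
      = (inner ℂ (wderivN 2 y.v₂) (wderivN 2 y.u₂) : ℂ).re := by
    rw [← inner_conj_symm, Complex.conj_re]
  have s5 : (inner ℂ y.q₁ y.q₁ : ℂ).re = ‖y.q₁‖ ^ 2 := (norm_sq_eq_re_inner (𝕜 := ℂ) y.q₁).symm
  simp only [map_zero, zero_mul, mul_zero, sub_zero, zero_sub] at i1 i2 i3 i4 i5
  have r1 := congrArg Complex.re i1
  have r2 := congrArg Complex.re i2
  have r3 := congrArg Complex.re i3
  have r4 := congrArg Complex.re i4
  have r5 := congrArg Complex.re i5
  have r6 : P.α₂ * (conj v0 * a).re = P.δ₁ / P.β₁ * P.α₁ * (conj v0 * b).re := by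
    rw [← Complex.re_ofReal_mul, ← Complex.re_ofReal_mul]
    congr 1
    linear_combination conj v0 * y11
  simp only [Complex.add_re, Complex.neg_re, Complex.zero_re] at r1 r2 r3 r4 r5
  rw [hE]
  simp only [inner_sub_right, inner_neg_right, inner_smul_right, Complex.add_re, Complex.sub_re,
    Complex.neg_re, Complex.re_ofReal_mul, s1, s2, s3, s4, s5]
  change _ + P.α₂ * (inner ℂ (wderiv (wderiv y.v₂)) (wderivN 2 y.u₂) : ℂ).re + _ = _
  have h1 : P.γ₁ * P.τ₁ / P.κ₁ * (1 / P.τ₁) = P.γ₁ / P.κ₁ := by field_simp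
  have h2 : P.γ₁ * P.τ₁ / P.κ₁ * (P.κ₁ / P.τ₁) = P.γ₁ := by field_simp
  have h3 : P.δ₁ / P.β₁ * P.β₁ = P.δ₁ := by field_simp
  have h4 : P.δ₁ * P.α₁ / P.β₁ = P.δ₁ / P.β₁ * P.α₁ := by ring
  rw [h4]
  linear_combination (P.δ₁ / P.β₁ * P.α₁) * r1 - P.δ₁ * r2 - P.γ₁ * r3 - P.α₂ * r4 + P.α₂ * r5
    + r6 - ‖y.q₁‖ ^ 2 * h1 - (inner ℂ y.q₁ (wderiv y.θ₁) : ℂ).re * h2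
    - (inner ℂ y.v₁ (wderiv y.θ₁) : ℂ).re * h3

/-- A state in the domain which is mapped to a multiple of itself and has no heat flux has neither
temperature difference nor velocity of the string. -/
lemma θ₁_eq_zero_and_v₁_eq_zero {y : EnergySpace P} (hy : y ∈ domA P) {c : ℂ}
    (h : opA P ⟨y, hy⟩ = c • y) (hq : y.q₁ = 0) : y.θ₁ = 0 ∧ y.v₁ = 0 := by
  obtain ⟨y1, y2, hv, ⟨y4, y5, y6⟩, y7, -⟩ := id hy
  have hθ : y.θ₁ = 0 := by
    refine eq_zero_of_wderiv_eq_zero P.ℓ₁_pos y4 ?_ (left_mem_Icc.2 P.ℓ₁_pos.le) y5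
    have e : -(((1 / P.τ₁ : ℝ) : ℂ) • y.q₁) - ((P.κ₁ / P.τ₁ : ℝ) : ℂ) • wderiv y.θ₁ = c • y.q₁ :=
      congrArg EnergySpace.q₁ h
    rw [hq, smul_zero, smul_zero, neg_zero, zero_sub, neg_eq_zero] at e
    exact (smul_eq_zero.1 e).resolve_left
      (Complex.ofReal_ne_zero.2 (div_pos P.κ₁_pos P.τ₁_pos).ne')
  refine ⟨hθ, ?_⟩
  refine eq_zero_of_wderiv_eq_zero P.ℓ₁_pos hv.1 ?_ (right_mem_Icc.2 P.ℓ₁_pos.le) hv.2.2.1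
  have e : -((P.γ₁ : ℂ) • wderiv y.q₁) - (P.δ₁ : ℂ) • wderiv y.v₁ = c • y.θ₁ :=
    congrArg EnergySpace.θ₁ h
  rw [hq, hθ, IsWeakDeriv.zero.wderiv_eq, smul_zero, smul_zero, neg_zero, zero_sub,
    neg_eq_zero] at e
  exact (smul_eq_zero.1 e).resolve_left (Complex.ofReal_ne_zero.2 P.δ₁_pos.ne')

lemma eq_zero_of_wderiv_eq_zero_of_wderivN_eq_zero {y : EnergySpace P} (h1 : wderiv y.u₁ = 0)
    (h2 : wderivN 2 y.u₂ = 0) (h3 : y.v₁ = 0) (h4 : y.v₂ = 0) (h5 : y.θ₁ = 0) (h6 : y.q₁ = 0) :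
    y = 0 := by
  have h := EnergySpace.norm_sq_eq y
  rw [h1, h2, h3, h4, h5, h6] at h
  simpa using h

lemma q₁_eq_zero_of_re_inner_eq_zero {y : EnergySpace P} (hy : y ∈ domA P)
    (h : (inner ℂ y (opA P ⟨y, hy⟩)).re = 0) : y.q₁ = 0 := by
  have h1 := re_inner_opA hy
  rw [h] at h1
  have h2 := (mul_eq_zero.1 (neg_eq_zero.1 h1.symm)).resolve_left
    (div_pos P.γ₁_pos P.κ₁_pos).ne'
  exact norm_eq_zero.1 (pow_eq_zero_iff two_ne_zero |>.1 h2)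

/-- The operator is injective: in its kernel `u₁` is affine and `u₂` is a cubic polynomial, and the
transmission conditions leave only zero because `det P ≠ 0`. -/
lemma eq_zero_of_opA_eq_zero {y : EnergySpace P} (hy : y ∈ domA P) (h : opA P ⟨y, hy⟩ = 0) :
    y = 0 := by
  have hq : y.q₁ = 0 := q₁_eq_zero_of_re_inner_eq_zero hy (by rw [h, inner_zero_right]; rfl)
  obtain ⟨hθ, hv₁⟩ := θ₁_eq_zero_and_v₁_eq_zero hy (c := 0) (by rw [h, zero_smul]) hq
  have hv₂ : y.v₂ = 0 := congrArg EnergySpace.u₂ h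
  obtain ⟨y1, y2, -, -, -, y8, a, b, y9, y10, y11⟩ := id hy
  have e1 : wderivN 2 y.u₁ = 0 := by
    have e : (P.α₁ : ℂ) • wderivN 2 y.u₁ - (P.β₁ : ℂ) • wderiv y.θ₁ = 0 :=
      congrArg EnergySpace.v₁ h
    rw [hθ, IsWeakDeriv.zero.wderiv_eq, smul_zero, sub_zero] at e
    exact (smul_eq_zero.1 e).resolve_left (Complex.ofReal_ne_zero.2 P.α₁_pos.ne')
  have e2 : wderivN 4 y.u₂ = 0 := by
    have e : -((P.α₂ : ℂ) • wderivN 4 y.u₂) = 0 := congrArg EnergySpace.v₂ h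
    exact (smul_eq_zero.1 (neg_eq_zero.1 e)).resolve_left
      (Complex.ofReal_ne_zero.2 P.α₂_pos.ne')
  have du1 : IsWeakDeriv (wderiv y.u₁) (wderivN 2 y.u₁) := isWeakDeriv_wderiv (wderiv_mem y1)
  have du2 : IsWeakDeriv (wderivN 2 y.u₂) (wderivN 3 y.u₂) :=
    isWeakDeriv_wderiv (wderiv_mem (wderiv_mem y2))
  have du3 : IsWeakDeriv (wderivN 3 y.u₂) (wderivN 4 y.u₂) :=
    isWeakDeriv_wderiv (wderiv_mem (wderiv_mem (wderiv_mem y2)))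
  have p1 : wderiv y.u₁ = b • one P.ℓ₁ := by
    rw [du1.eq_of_hasValueAt_zero P.ℓ₁_pos y10, e1, map_zero, add_zero]
  have p2 : wderivN 2 y.u₂ = a • N P.ℓ₂ (one P.ℓ₂) := by
    rw [du2.eq_N P.ℓ₂_pos y8, du3.eq_of_hasValueAt_zero P.ℓ₂_pos y9, e2, map_zero, add_zero,
      map_smul]
  have p3 : b * P.ℓ₁ = a * tot P.ℓ₂ (J P.ℓ₂ (N P.ℓ₂ (one P.ℓ₂))) := by
    have h2 := V.tot_eq y.u_mem
    simp only at h2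
    rw [p1, p2] at h2
    simpa [tot_one P.ℓ₁_pos] using h2
  have ha : a = ratio P * b := by
    have h2 : (P.α₂ : ℂ) ≠ 0 := Complex.ofReal_ne_zero.2 P.α₂_pos.ne'
    refine mul_left_cancel₀ h2 (y11.trans ?_)
    rw [ratio]
    push_cast
    field_simp
  have hb : b = 0 := by
    refine (mul_eq_zero.1 (?_ : ((det P : ℝ) : ℂ) * b = 0)).resolve_left
      (Complex.ofReal_ne_zero.2 (det_pos P).ne')
    rw [ofReal_det]
    rw [ha] at p3
    linear_combination p3
  refine eq_zero_of_wderiv_eq_zero_of_wderivN_eq_zero ?_ ?_ hv₁ hv₂ hθ hq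
  · rw [p1, hb, zero_smul]
  · rw [p2, ha, hb, mul_zero, zero_smul]

/-! ### Absence of imaginary eigenvalues -/

lemma eq_zero_of_eq_neg_sq_smul_J_J {ℓ : ℝ} {k : ℝ} {u : L2 ℓ}
    (h : u = -((k : ℂ) ^ 2 • J ℓ (J ℓ u))) : u = 0 := by
  -- `1 + k² J² = (1 - i k J) (1 + i k J)`
  have h1 : u + ((k : ℂ) * Complex.I) • J ℓ u = 0 := by
    refine eq_zero_of_eq_smul_J (c := (k : ℂ) * Complex.I) ?_
    rw [map_add, map_smul, smul_add, smul_smul,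
      show (k : ℂ) * Complex.I * (k * Complex.I) = -(k : ℂ) ^ 2 by
        linear_combination (k : ℂ) ^ 2 * Complex.I_mul_I, neg_smul, ← h, add_comm]
  refine eq_zero_of_eq_smul_J (c := -((k : ℂ) * Complex.I)) ?_
  rw [neg_smul]
  exact eq_neg_of_add_eq_zero_left h1

/-- A beam mode with wave number `k` which is clamped and shear-free at `0` and hinged at `ℓ`
vanishes. Indeed `w = ∂ₓ² u + k² u` solves `∂ₓ² w = k² w` with `∂ₓ w(0) = 0` and `w(ℓ) = 0`, so it
is zero, and `u` solves `∂ₓ² u = -k² u` with zero Cauchy data. -/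
lemma beam_eq_zero {ℓ : ℝ} (hℓ : 0 < ℓ) {k : ℝ} (hk : 0 < k) {u : L2 ℓ} (hu : u ∈ Sobolev ℓ 4)
    (h4 : wderivN 4 u = (k : ℂ) ^ 4 • u) (h0 : HasValueAt u 0 0) (h1 : HasValueAt (wderiv u) 0 0)
    (h3 : HasValueAt (wderivN 3 u) 0 0) (hu0 : HasValueAt u ℓ 0)
    (hu2 : HasValueAt (wderivN 2 u) ℓ 0) : u = 0 := by
  have d1 : IsWeakDeriv u (wderiv u) := isWeakDeriv_wderiv hu
  have d2 : IsWeakDeriv (wderiv u) (wderivN 2 u) := isWeakDeriv_wderiv (wderiv_mem hu)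
  have d3 : IsWeakDeriv (wderivN 2 u) (wderivN 3 u) :=
    isWeakDeriv_wderiv (wderiv_mem (wderiv_mem hu))
  have d4 : IsWeakDeriv (wderivN 3 u) (wderivN 4 u) :=
    isWeakDeriv_wderiv (wderiv_mem (wderiv_mem (wderiv_mem hu)))
  set w := wderivN 2 u + (k : ℂ) ^ 2 • u with hw
  set w' := wderivN 3 u + (k : ℂ) ^ 2 • wderiv u with hw'
  have dw : IsWeakDeriv w w' := d3.add (d1.smul _)
  have dw' : IsWeakDeriv w' ((k : ℂ) ^ 2 • w) := by
    have h := d4.add (d2.smul ((k : ℂ) ^ 2))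
    rw [h4] at h
    convert h using 1
    rw [hw]
    module
  have v1 : HasValueAt w ℓ 0 := by simpa using hu2.add (hu0.smul ((k : ℂ) ^ 2))
  have v2 : HasValueAt w' 0 0 := by simpa using h3.add (h1.smul ((k : ℂ) ^ 2))
  obtain ⟨c, hc, -⟩ := dw.exists_hasValueAt hℓ
  obtain ⟨d, -, hd⟩ := dw'.exists_hasValueAt hℓ
  have hi := dw'.inner_add_inner hℓ dw v2 hd hc v1
  have hw0 : w = 0 := by
    have hr := congrArg Complex.re hi
    have e1 : (inner ℂ w w : ℂ).re = ‖w‖ ^ 2 := (norm_sq_eq_re_inner (𝕜 := ℂ) w).symm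
    have e2 : (inner ℂ w' w' : ℂ).re = ‖w'‖ ^ 2 := (norm_sq_eq_re_inner (𝕜 := ℂ) w').symm
    rw [inner_smul_left, ← Complex.ofReal_pow, Complex.conj_ofReal, Complex.add_re,
      Complex.re_ofReal_mul, e1, e2] at hr
    simp only [mul_zero, map_zero, zero_mul, sub_zero, Complex.zero_re] at hr
    have p1 : 0 ≤ k ^ 2 * ‖w‖ ^ 2 := by positivity
    have p2 : 0 ≤ ‖w'‖ ^ 2 := by positivity
    have p3 : k ^ 2 * ‖w‖ ^ 2 = 0 := by linarith
    have p4 := (mul_eq_zero.1 p3).resolve_left (by positivity)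
    exact norm_eq_zero.1 (pow_eq_zero_iff two_ne_zero |>.1 p4)
  refine eq_zero_of_eq_neg_sq_smul_J_J (k := k) ?_
  have e1 : wderivN 2 u = -((k : ℂ) ^ 2 • u) := eq_neg_of_add_eq_zero_left hw0
  have e2 : u = J ℓ (J ℓ (wderivN 2 u)) := by
    rw [← d2.eq_J hℓ h1, ← d1.eq_J hℓ h0]
  conv_lhs => rw [e2, e1]
  rw [map_neg, map_neg, map_smul, map_smul]

/-- The operator has no nonzero eigenvalue on the imaginary axis: an eigenvector has no heat flux,
so the string is at rest, and the beam satisfies the conditions of `beam_eq_zero`. -/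
lemma eq_zero_of_opA_eq_I_smul {μ : ℝ} (hμ : μ ≠ 0) {y : EnergySpace P} (hy : y ∈ domA P)
    (h : opA P ⟨y, hy⟩ = ((μ : ℂ) * Complex.I) • y) : y = 0 := by
  have hc : (μ : ℂ) * Complex.I ≠ 0 := mul_ne_zero (Complex.ofReal_ne_zero.2 hμ) Complex.I_ne_zero
  have hq : y.q₁ = 0 := by
    refine q₁_eq_zero_of_re_inner_eq_zero hy ?_
    rw [h, inner_smul_right, inner_self_eq_norm_sq_to_K, mul_assoc, Complex.re_ofReal_mul]
    have e : Complex.I * ((‖y‖ : ℝ) : ℂ) ^ 2 = Complex.I * ((‖y‖ ^ 2 : ℝ) : ℂ) := by push_cast; rfl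
    have e2 : (Complex.I * ((‖y‖ : ℝ) : ℂ) ^ 2).re = 0 := by
      rw [e, Complex.re_mul_ofReal, Complex.I_re, zero_mul]
    exact mul_eq_zero_of_right _ e2
  obtain ⟨hθ, hv₁⟩ := θ₁_eq_zero_and_v₁_eq_zero hy h hq
  obtain ⟨y1, y2, -, -, -, y8, a, b, y9, y10, y11⟩ := id hy
  have hu₁ : y.u₁ = 0 := by
    have e : y.v₁ = ((μ : ℂ) * Complex.I) • y.u₁ := congrArg EnergySpace.u₁ h
    rw [hv₁] at e
    exact (smul_eq_zero.1 e.symm).resolve_left hc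
  have hv₂ : y.v₂ = ((μ : ℂ) * Complex.I) • y.u₂ := congrArg EnergySpace.u₂ h
  have hℓ₁ := left_mem_Icc.2 P.ℓ₁_pos.le
  have hb : b = 0 := by
    rw [hu₁, IsWeakDeriv.zero.wderiv_eq] at y10
    exact y10.unique P.ℓ₁_pos hℓ₁ (.zero 0)
  have ha : a = 0 := by
    rw [hb, mul_zero] at y11
    exact (mul_eq_zero.1 y11).resolve_left (Complex.ofReal_ne_zero.2 P.α₂_pos.ne')
  rw [ha] at y9
  obtain ⟨u1, u2, u3, u4, ⟨c, u5, u6⟩, u7⟩ := y.u_mem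
  simp only at u3 u4 u5 u6 u7
  have hc0 : c = 0 := by
    rw [hu₁] at u5
    exact u5.unique P.ℓ₁_pos hℓ₁ (.zero 0)
  rw [hc0] at u6
  have hα₂ := P.α₂_pos
  have hu₂ : y.u₂ = 0 := by
    -- the wave number of the beam at frequency `μ`
    have hpos : 0 < μ ^ 2 / P.α₂ := by positivity
    refine beam_eq_zero P.ℓ₂_pos (Real.sqrt_pos.2 (Real.sqrt_pos.2 hpos)) y2 ?_ u6 u7 y9 u4 y8
    have e : -((P.α₂ : ℂ) • wderivN 4 y.u₂) = ((μ : ℂ) * Complex.I) • y.v₂ :=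
      congrArg EnergySpace.v₂ h
    rw [hv₂, smul_smul, show (μ : ℂ) * Complex.I * (μ * Complex.I) = -(μ : ℂ) ^ 2 by
      linear_combination (μ : ℂ) ^ 2 * Complex.I_mul_I, neg_smul, neg_inj] at e
    have e2 : √√(μ ^ 2 / P.α₂) ^ 4 = μ ^ 2 / P.α₂ := by
      rw [show 4 = 2 * 2 from rfl, pow_mul, Real.sq_sqrt (Real.sqrt_nonneg _),
        Real.sq_sqrt hpos.le]
    rw [← Complex.ofReal_pow, e2]
    have hα : (P.α₂ : ℂ) ≠ 0 := Complex.ofReal_ne_zero.2 hα₂.ne'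
    have e3 := congrArg (fun f => (P.α₂ : ℂ)⁻¹ • f) e
    simp only [smul_smul] at e3
    rw [inv_mul_cancel₀ hα, one_smul] at e3
    rw [e3]
    congr 1
    push_cast
    field_simp
  refine EnergySpace.ext hu₁ hu₂ hv₁ ?_ hθ hq
  rw [hv₂, hu₂, smul_zero]
  rfl

/-! ### The operator as the inverse of a compact dissipative operator -/

lemma inverseA_opA {y : EnergySpace P} (hy : y ∈ domA P) : inverseA P (opA P ⟨y, hy⟩) = y := by
  set F := opA P ⟨y, hy⟩ with hF
  have hmem : inverseA P F - y ∈ domA P := sub_mem (inverseA_mem F) hy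
  refine sub_eq_zero.1 (eq_zero_of_opA_eq_zero hmem ?_)
  have h := (opA P).map_sub ⟨inverseA P F, inverseA_mem F⟩ ⟨y, hy⟩
  rw [opA_inverseA, ← hF, sub_self] at h
  exact h

lemma exists_opA_eq_iff (x z : EnergySpace P) :
    (∃ hx : x ∈ (opA P).domain, opA P ⟨x, hx⟩ = z) ↔ x = inverseA P z := by
  constructor
  · rintro ⟨hx, rfl⟩
    exact (inverseA_opA hx).symm
  · rintro rfl
    exact ⟨inverseA_mem z, opA_inverseA z⟩

lemma isDissipativeInverse_inverseA : IsDissipativeInverse (inverseA P) where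
  injective x z h := by
    obtain ⟨_, h1⟩ := (exists_opA_eq_iff (inverseA P z) x).2 h.symm
    rw [← h1, opA_inverseA]
  re_inner_nonpos z := by
    have h := re_inner_opA (inverseA_mem z)
    rw [opA_inverseA] at h
    rw [← inner_conj_symm, Complex.conj_re, h, neg_nonpos]
    exact mul_nonneg (div_pos P.γ₁_pos P.κ₁_pos).le (sq_nonneg _)

lemma eq_zero_of_inverseA_eq_I_smul (r : ℝ) (z : EnergySpace P) (hr : r ≠ 0)
    (h : inverseA P z = ((r : ℂ) * Complex.I) • z) : z = 0 := by
  have hr' : (r : ℂ) ≠ 0 := Complex.ofReal_ne_zero.2 hr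
  have e : ((r⁻¹ : ℝ) : ℂ) * Complex.I * ((r : ℂ) * Complex.I) = -1 := by
    push_cast
    field_simp
    exact Complex.I_sq
  have hz : inverseA P ((((-r⁻¹ : ℝ) : ℂ) * Complex.I) • z) = z := by
    rw [map_smul, h, smul_smul, Complex.ofReal_neg, neg_mul, neg_mul, e, neg_neg, one_smul]
  obtain ⟨hzd, hA⟩ := (exists_opA_eq_iff z _).2 hz.symm
  exact eq_zero_of_opA_eq_I_smul (neg_ne_zero.2 (inv_ne_zero hr)) hzd hA

end Dissipation

end StringBeam

end

theorem mainTheorem4 (P : StringBeam.Params) :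
    ∃ T : StringBeam.C0Semigroup (StringBeam.EnergySpace P),
      T.IsGenerator (StringBeam.opA P) ∧
      (∀ t : ℝ≥0, ‖T.S t‖ ≤ 1) ∧
      ∀ y : StringBeam.EnergySpace P, Tendsto (fun t : ℝ≥0 => ‖T.S t y‖) atTop (𝓝 0) := by
  have hB := StringBeam.isDissipativeInverse_inverseA (P := P)
  refine ⟨hB.semigroup, fun x z => ?_, hB.norm_semigroupOp_le_one, fun y =>
    hB.tendsto_norm_semigroupOp StringBeam.isCompactOperator_inverseA
      StringBeam.eq_zero_of_inverseA_eq_I_smul y⟩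
  rw [StringBeam.exists_opA_eq_iff]
  exact (hB.tendsto_inv_smul_semigroupOp_sub_iff x z).symm
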